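/- Let $D^3\subset\mathbb R^3$ be the closed unit ball, whose interior with the metric $4|dx|^2/(1-|x|^2)^2$ is hyperbolic space $\mathcal H^3$ and whose boundary is $S^2=\mathbb{CP}_1$; the group $PSL(2,\mathbb C)$ of orientation-preserving isometries of $\mathcal H^3$ acts on $D^3$. Call a discrete subgroup $\Gamma\subset PSL(2,\mathbb C)$ a *quasi-Fuchsian group of Bers type* if * $\Gamma=\Phi^{-1}\circ\Gamma'\circ\Phi$ for some quasiconformal homeomorphism $\Phi$ of $S^2$ and some Fuchsian group $\Gamma'$ of the first type (a discrete subgroup of $PSL(2,\mathbb C)$ that maps a round disk of $S^2$ to itself and whose limit set is the whole boundary circle of this disk), and * $\Gamma$ is isomorphic to $\pi_1(\Sigma)$ for some compact connected oriented surface $\Sigma$ of genus at least $2$. Let $\Gamma$ be such a group, let $\Lambda\subset S^2$ be its limit set (the set of accumulation points on $S^2$ of the $\Gamma$-orbit of any point of $\mathcal H^3$; it does not depend on the point), and let $X=\mathcal H^3/\Gamma\subset\overline X=(D^3-\Lambda)/\Gamma$. The boundary $\partial\overline X=(S^2-\Lambda)/\Gamma$ is the union of two connected components $\Sigma_+$ and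 $\Sigma_-$. The *tunnel-vision function* of $X$ is the unique continuous function $f:\overline X\to[0,1]$ that is harmonic on $X$ for the hyperbolic metric, equal to $1$ on $\Sigma_+$ and equal to $0$ on $\Sigma_-$. **Lemma.** At every point of $\partial\overline X$, the first normal derivative of the tunnel-vision function $f$ is zero, but its second normal derivative is non-zero. Explicitly: the pull-back $\tilde f$ of $f$ to $D^3-\Lambda$ is $C^2$ up to the boundary; and if $q\in S^2-\Lambda$ and $c:[0,\varepsilon]\to D^3-\Lambda$ (where $\varepsilon>0$) is any $C^2$ curve with $c(0)=q$ and $c'(0)=-\ell q$ for some $\ell>0$ (so that $c$ leaves $q$ along the inward normal), then $(\tilde f\circ c)'(0)=0$ and $(\tilde f\circ c)''(0)\neq 0$. In particular this holds for the geodesics normal to the boundary of every smooth Riemannian metric on $\overline X$ in the conformal class induced by the Euclidean metric of $D^3$. -/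

import Mathlib

open scoped MatrixGroups ContDiff Manifold Topology

noncomputable section

namespace QuasiFuchsian

/-- Euclidean `3`-space, the ambient space of the ball model. -/
abbrev E3 : Type := EuclideanSpace ℝ (Fin 3)

/-- The closed unit ball `D³`; its open part, with the metric `4|dx|² / (1 - |x|²)²`,
is hyperbolic `3`-space `ℋ³`. -/
abbrev D3 : Type := {x : E3 // ‖x‖ ≤ 1}

/-- The sphere at infinity `S² = ℂℙ₁`, with the chordal metric. -/
abbrev S2 : Type := {x : E3 // ‖x‖ = 1}

/-- The inclusion of the sphere at infinity in the closed ball. -/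
def S2.toD3 (q : S2) : D3 := ⟨q.1, q.2.le⟩

/-! ### The action of `PSL(2, ℂ)` on the closed ball -/

/-- The Hermitian matrix `X = x₀ σ₁ + x₁ σ₂ + x₂ σ₃` attached to `x ∈ ℝ³`. -/
def pauli (x : E3) : Matrix (Fin 2) (Fin 2) ℂ :=
  !![(x 2 : ℂ), (x 0 : ℂ) - (x 1 : ℂ) * Complex.I; (x 0 : ℂ) + (x 1 : ℂ) * Complex.I, -(x 2 : ℂ)]

/-- The Hermitian matrix `(1 + |x|²) I + 2 X`, of determinant `(1 - |x|²)²`.  Identifying Hermitian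
`2 × 2` matrices with Minkowski space, it spans the future-pointing ray (timelike for `|x| < 1`,
null for `|x| = 1`) that corresponds to the point `x` of the closed Poincaré ball. -/
def hermOf (x : E3) : Matrix (Fin 2) (Fin 2) ℂ :=
  ((1 + ‖x‖ ^ 2 : ℝ) : ℂ) • (1 : Matrix (Fin 2) (Fin 2) ℂ) + (2 : ℂ) • pauli x

/-- The time coordinate `T` of a Hermitian matrix `T I + Y`, `Y` trace-free. -/
def timePart (M : Matrix (Fin 2) (Fin 2) ℂ) : ℝ := ((M 0 0).re + (M 1 1).re) / 2

/-- The space coordinates of a Hermitian matrix `T I + Y`, `Y` trace-free. -/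
def spacePart (M : Matrix (Fin 2) (Fin 2) ℂ) : E3 :=
  !₂[(M 1 0).re, (M 1 0).im, ((M 0 0).re - (M 1 1).re) / 2]

/-- The transform `A (hermOf x) A*`. -/
def conjHerm (A : SL(2, ℂ)) (x : E3) : Matrix (Fin 2) (Fin 2) ℂ :=
  A.1 * hermOf x * A.1.conjTranspose

/-- The action of `A` on the closed Poincaré ball: the point of the ball whose ray is
spanned by `A (hermOf x) A* = T I + Y`, namely `Y / (T + √(det))`, where
`√(det) = 1 - |x|²` because `det A = 1`. -/
def moebius (A : SL(2, ℂ)) (x : E3) : E3 :=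
  (timePart (conjHerm A x) + (1 - ‖x‖ ^ 2))⁻¹ • spacePart (conjHerm A x)

lemma norm_sq_E3 (x : E3) : ‖x‖ ^ 2 = x 0 ^ 2 + x 1 ^ 2 + x 2 ^ 2 := by
  rw [EuclideanSpace.norm_sq_eq, Fin.sum_univ_three]
  simp

lemma det_hermOf (x : E3) : (hermOf x).det = (((1 - ‖x‖ ^ 2) ^ 2 : ℝ) : ℂ) := by
  have h := norm_sq_E3 x
  rw [hermOf, Matrix.det_fin_two]
  simp only [pauli, h, Matrix.add_apply, Matrix.smul_apply, Matrix.one_apply, Matrix.of_apply,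
    Matrix.cons_val', Matrix.cons_val_zero, Matrix.cons_val_one, Matrix.cons_val_fin_one,
    smul_eq_mul]
  push_cast
  simp
  ring_nf
  simp
  ring

lemma isHermitian_hermOf (x : E3) : (hermOf x).IsHermitian := by
  ext i j
  fin_cases i <;> fin_cases j <;> simp [hermOf, pauli, Complex.ext_iff]

lemma isHermitian_conjHerm (A : SL(2, ℂ)) (x : E3) : (conjHerm A x).IsHermitian := by
  have h := isHermitian_hermOf x
  unfold Matrix.IsHermitian at *
  simp [conjHerm, Matrix.conjTranspose_mul, h, Matrix.mul_assoc]

lemma det_conjHerm (A : SL(2, ℂ)) (x : E3) :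
    (conjHerm A x).det = (((1 - ‖x‖ ^ 2) ^ 2 : ℝ) : ℂ) := by
  simp [conjHerm, Matrix.det_mul, Matrix.det_conjTranspose, det_hermOf]

lemma timePart_sq {M : Matrix (Fin 2) (Fin 2) ℂ} (hM : M.IsHermitian) :
    timePart M ^ 2 = M.det.re + ‖spacePart M‖ ^ 2 := by
  have h00 : (M 0 0).im = 0 := by
    have := congrArg Complex.im (hM.apply 0 0); simp at this; linarith
  have h11 : (M 1 1).im = 0 := by
    have := congrArg Complex.im (hM.apply 1 1); simp at this; linarith
  have h01 : M 0 1 = star (M 1 0) := (hM.apply 0 1).symm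
  rw [norm_sq_E3, Matrix.det_fin_two, h01]
  simp [timePart, spacePart, h00, h11]
  ring

lemma eq_of_parts {M N : Matrix (Fin 2) (Fin 2) ℂ} (hM : M.IsHermitian) (hN : N.IsHermitian)
    (ht : timePart M = timePart N) (hs : spacePart M = spacePart N) : M = N := by
  have h0 := congrArg (fun v : E3 => v 0) hs
  have h1 := congrArg (fun v : E3 => v 1) hs
  have h2 := congrArg (fun v : E3 => v 2) hs
  simp [spacePart] at h0 h1 h2
  unfold timePart at ht
  have im0 : ∀ {M : Matrix (Fin 2) (Fin 2) ℂ}, M.IsHermitian → ∀ i, (M i i).im = 0 := by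
    intro M hM i
    have := congrArg Complex.im (hM.apply i i); simp at this; linarith
  have h10 : M 1 0 = N 1 0 := Complex.ext h0 h1
  ext i j
  fin_cases i <;> fin_cases j
  · exact Complex.ext (by simp; linarith) (by simp [im0 hM, im0 hN])
  · have a := hM.apply 0 1
    have b := hN.apply 0 1
    simp only [Fin.zero_eta, Fin.mk_one]
    rw [← a, ← b, h10]
  · exact h10
  · exact Complex.ext (by simp; linarith) (by simp [im0 hM, im0 hN])

lemma timePart_smul (c : ℝ) (M : Matrix (Fin 2) (Fin 2) ℂ) :
    timePart ((c : ℂ) • M) = c * timePart M := by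
  simp [timePart]; ring

lemma spacePart_smul (c : ℝ) (M : Matrix (Fin 2) (Fin 2) ℂ) :
    spacePart ((c : ℂ) • M) = c • spacePart M := by
  ext i; fin_cases i <;> simp [spacePart]; ring

lemma timePart_hermOf (x : E3) : timePart (hermOf x) = 1 + ‖x‖ ^ 2 := by
  simp [timePart, hermOf, pauli, ← Complex.ofReal_pow]; ring

lemma spacePart_hermOf (x : E3) : spacePart (hermOf x) = (2 : ℝ) • x := by
  ext i; fin_cases i <;> simp [spacePart, hermOf, pauli]

lemma hermOf_eq_sq (x : E3) : hermOf x = (1 + pauli x) * (1 + pauli x).conjTranspose := by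
  have h := norm_sq_E3 x
  ext i j
  fin_cases i <;> fin_cases j <;>
    simp [hermOf, pauli, Matrix.mul_apply, Fin.sum_univ_two, h, Complex.ext_iff] <;> ring_nf
  all_goals simp [← Complex.ofReal_pow]
  all_goals ring

lemma timePart_conjHerm_pos (A : SL(2, ℂ)) (x : E3) : 0 < timePart (conjHerm A x) := by
  set B := A.1 * (1 + pauli x) with hB
  have hM : conjHerm A x = B * B.conjTranspose := by
    rw [conjHerm, hermOf_eq_sq, hB, Matrix.conjTranspose_mul]
    simp only [Matrix.mul_assoc]
  have ht : timePart (conjHerm A x) =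
      (Complex.normSq (B 0 0) + Complex.normSq (B 0 1) + Complex.normSq (B 1 0)
        + Complex.normSq (B 1 1)) / 2 := by
    rw [hM]
    simp [timePart, Matrix.mul_apply, Fin.sum_univ_two, Complex.normSq_apply]
    ring
  rw [ht]
  have n00 := Complex.normSq_nonneg (B 0 0)
  have n01 := Complex.normSq_nonneg (B 0 1)
  have n10 := Complex.normSq_nonneg (B 1 0)
  have n11 := Complex.normSq_nonneg (B 1 1)
  by_contra hcon
  have z00 : B 0 0 = 0 := Complex.normSq_eq_zero.1 (by linarith)
  have z01 : B 0 1 = 0 := Complex.normSq_eq_zero.1 (by linarith)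
  have z10 : B 1 0 = 0 := Complex.normSq_eq_zero.1 (by linarith)
  have z11 : B 1 1 = 0 := Complex.normSq_eq_zero.1 (by linarith)
  have hB0 : B = 0 := by
    ext i j; fin_cases i <;> fin_cases j <;> simp [z00, z01, z10, z11]
  have hX : (1 + pauli x) = 0 := by
    have : (A⁻¹ : SL(2, ℂ)).1 * B = 1 + pauli x := by
      rw [hB, ← Matrix.mul_assoc, ← Matrix.SpecialLinearGroup.coe_mul]
      simp
    rw [← this, hB0, Matrix.mul_zero]
  have e0 := congrFun (congrFun hX 0) 0
  have e1 := congrFun (congrFun hX 1) 1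
  simp [pauli] at e0 e1
  have : (2 : ℂ) = 0 := by linear_combination e0 + e1
  norm_num at this

/-- Half of `T + √(det)`, the positive factor between `hermOf (moebius A x)` and `conjHerm A x`. -/
def scaleFactor (A : SL(2, ℂ)) (x : E3) : ℝ := (timePart (conjHerm A x) + (1 - ‖x‖ ^ 2)) / 2

lemma scaleFactor_pos (A : SL(2, ℂ)) {x : E3} (hx : ‖x‖ ≤ 1) : 0 < scaleFactor A x := by
  have h := timePart_conjHerm_pos A x
  have : ‖x‖ ^ 2 ≤ 1 := by nlinarith [norm_nonneg x]
  unfold scaleFactor; linarith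

lemma moebius_eq (A : SL(2, ℂ)) (x : E3) :
    moebius A x = (2 * scaleFactor A x)⁻¹ • spacePart (conjHerm A x) := by
  unfold moebius scaleFactor
  congr 2; ring

lemma scale_norm (A : SL(2, ℂ)) {x : E3} (hx : ‖x‖ ≤ 1) :
    scaleFactor A x * (1 - ‖moebius A x‖ ^ 2) = 1 - ‖x‖ ^ 2 := by
  have hp := scaleFactor_pos A hx
  have h1 := timePart_sq (isHermitian_conjHerm A x)
  rw [det_conjHerm, Complex.ofReal_re] at h1
  have h2 : timePart (conjHerm A x) = 2 * scaleFactor A x - (1 - ‖x‖ ^ 2) := by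
    unfold scaleFactor; ring
  rw [moebius_eq, norm_smul, mul_pow, Real.norm_eq_abs, sq_abs]
  rw [h2] at h1
  have h3 : ‖spacePart (conjHerm A x)‖ ^ 2
      = (2 * scaleFactor A x - (1 - ‖x‖ ^ 2)) ^ 2 - (1 - ‖x‖ ^ 2) ^ 2 := by linarith
  rw [h3]
  field_simp
  ring

lemma scale_herm (A : SL(2, ℂ)) {x : E3} (hx : ‖x‖ ≤ 1) :
    ((scaleFactor A x : ℝ) : ℂ) • hermOf (moebius A x) = conjHerm A x := by
  have hp := scaleFactor_pos A hx
  have hn := scale_norm A hx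
  have h2 : timePart (conjHerm A x) = 2 * scaleFactor A x - (1 - ‖x‖ ^ 2) := by
    unfold scaleFactor; ring
  apply eq_of_parts
  · have h := isHermitian_hermOf (moebius A x)
    unfold Matrix.IsHermitian at *
    simp [Matrix.conjTranspose_smul, h]
  · exact isHermitian_conjHerm A x
  · rw [timePart_smul, timePart_hermOf, h2]; linarith
  · rw [spacePart_smul, spacePart_hermOf, moebius_eq, smul_smul, smul_smul]
    have : scaleFactor A x * (2 * (2 * scaleFactor A x)⁻¹) = 1 := by field_simp
    rw [mul_assoc, this, one_smul]

lemma norm_moebius_le (A : SL(2, ℂ)) {x : E3} (hx : ‖x‖ ≤ 1) : ‖moebius A x‖ ≤ 1 := by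
  have hp := scaleFactor_pos A hx
  have hn := scale_norm A hx
  have : 0 ≤ 1 - ‖x‖ ^ 2 := by nlinarith [norm_nonneg x]
  have h3 : 0 ≤ 1 - ‖moebius A x‖ ^ 2 := by
    by_contra hc
    push Not at hc
    nlinarith
  nlinarith [norm_nonneg (moebius A x)]

lemma norm_moebius_eq (A : SL(2, ℂ)) {x : E3} (hx : ‖x‖ = 1) : ‖moebius A x‖ = 1 := by
  have hp := scaleFactor_pos A hx.le
  have hn := scale_norm A hx.le
  rw [hx] at hn
  have h3 : 1 - ‖moebius A x‖ ^ 2 = 0 := by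
    rcases mul_eq_zero.1 (by linarith : scaleFactor A x * (1 - ‖moebius A x‖ ^ 2) = 0) with h | h
    · exact absurd h hp.ne'
    · exact h
  nlinarith [norm_nonneg (moebius A x)]

lemma moebius_of_conjHerm_eq (A : SL(2, ℂ)) (x : E3) (h : conjHerm A x = hermOf x) :
    moebius A x = x := by
  rw [moebius, h, timePart_hermOf, spacePart_hermOf, smul_smul]
  have : (1 + ‖x‖ ^ 2 + (1 - ‖x‖ ^ 2))⁻¹ * 2 = 1 := by
    have : 1 + ‖x‖ ^ 2 + (1 - ‖x‖ ^ 2) = 2 := by ring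
    rw [this]; norm_num
  rw [this, one_smul]

lemma moebius_mul (A B : SL(2, ℂ)) {x : E3} (hx : ‖x‖ ≤ 1) :
    moebius (A * B) x = moebius A (moebius B x) := by
  have hp := scaleFactor_pos B hx
  have hn := scale_norm B hx
  have hh := scale_herm B hx
  have hc : conjHerm (A * B) x
      = ((scaleFactor B x : ℝ) : ℂ) • conjHerm A (moebius B x) := by
    have : conjHerm (A * B) x = A.1 * conjHerm B x * A.1.conjTranspose := by
      simp [conjHerm, Matrix.conjTranspose_mul, Matrix.mul_assoc]
    rw [this, ← hh, conjHerm]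
    simp
  rw [moebius, hc, timePart_smul, spacePart_smul, ← hn, ← mul_add, smul_smul, moebius]
  congr 1
  rw [mul_inv, mul_comm, ← mul_assoc, mul_inv_cancel₀ hp.ne', one_mul]

instance : MulAction SL(2, ℂ) D3 where
  smul A x := ⟨moebius A x.1, norm_moebius_le A x.2⟩
  one_smul x := Subtype.ext (moebius_of_conjHerm_eq 1 x.1 (by simp [conjHerm]))
  mul_smul A B x := Subtype.ext (moebius_mul A B x.2)

lemma coe_smul_D3 (A : SL(2, ℂ)) (x : D3) : ((A • x : D3) : E3) = moebius A x.1 := rfl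

lemma center_le_ker :
    Subgroup.center SL(2, ℂ) ≤ (MulAction.toPermHom SL(2, ℂ) D3).ker := by
  intro A hA
  rw [Matrix.SpecialLinearGroup.mem_center_iff] at hA
  obtain ⟨r, hr, hrA⟩ := hA
  rw [MonoidHom.mem_ker]
  ext1 x
  apply Subtype.ext
  change moebius A x.1 = x.1
  apply moebius_of_conjHerm_eq
  have hn : ‖r‖ = 1 := by
    have := congrArg norm hr
    rw [Fintype.card_fin, norm_pow, norm_one] at this
    nlinarith [norm_nonneg r]
  have hr2 : r * (starRingEnd ℂ) r = 1 := by
    rw [Complex.mul_conj, Complex.normSq_eq_norm_sq, hn]; simp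
  rw [conjHerm, ← hrA]
  ext i j
  fin_cases i <;> fin_cases j <;>
    simp [Matrix.scalar_apply, Matrix.mul_apply, Fin.sum_univ_two, Matrix.diagonal] <;>
    linear_combination (hermOf x.1 _ _) * hr2

/-- `PSL(2, ℂ)` acts on the closed ball `D³` through the action of `SL(2, ℂ)`. -/
def pslToPerm : PSL(2, ℂ) →* Equiv.Perm D3 :=
  QuotientGroup.lift _ (MulAction.toPermHom SL(2, ℂ) D3) center_le_ker

instance : MulAction PSL(2, ℂ) D3 := MulAction.compHom D3 pslToPerm

lemma psl_mk_smul (A : SL(2, ℂ)) (x : D3) :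
    (QuotientGroup.mk A : PSL(2, ℂ)) • x = A • x := rfl

lemma psl_smul_norm_eq (γ : PSL(2, ℂ)) {x : D3} (hx : ‖x.1‖ = 1) : ‖(γ • x).1‖ = 1 := by
  induction γ using QuotientGroup.induction_on with
  | H A => exact norm_moebius_eq A hx

/-- The induced action of `PSL(2, ℂ)` on the sphere at infinity. -/
instance : MulAction PSL(2, ℂ) S2 where
  smul γ q := ⟨(γ • q.toD3).1, psl_smul_norm_eq γ q.2⟩
  one_smul q := Subtype.ext (by exact congrArg (Subtype.val : D3 → E3) (one_smul PSL(2, ℂ) q.toD3))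
  mul_smul γ δ q := Subtype.ext (by exact congrArg (Subtype.val : D3 → E3) (mul_smul γ δ q.toD3))

/-! ### Kleinian, Fuchsian and quasi-Fuchsian groups -/

/-- A Kleinian group is a discrete subgroup of `PSL(2, ℂ)`. -/
def IsKleinian (Γ : Subgroup PSL(2, ℂ)) : Prop := DiscreteTopology Γ

/-- The center of the ball, as a point of `ℋ³`. -/
def center : D3 := ⟨0, by simp⟩

/-- The limit set: the points of the sphere at infinity at which the orbit of a point of `ℋ³`
accumulates; for a Kleinian group it does not depend on the point, which is taken to be the
center of the ball. -/
def limitSet (Γ : Subgroup PSL(2, ℂ)) : Set S2 :=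
  {q | AccPt q.toD3 (Filter.principal (MulAction.orbit Γ center))}

/-- The round open disk of the sphere with axis `v`; for `|v| = 1` and `|c| < 1` these are exactly
the geometric open disks. -/
def roundDisk (v : E3) (c : ℝ) : Set S2 := {q | c < inner ℝ v q.1}

/-- The boundary circle of `roundDisk v c`. -/
def roundCircle (v : E3) (c : ℝ) : Set S2 := {q | inner ℝ v q.1 = c}

/-- A Fuchsian group of the first type: a Kleinian group that maps a geometric disk to itself and
whose limit set is the whole boundary circle of this disk. -/
def IsFuchsianFirstType (Γ : Subgroup PSL(2, ℂ)) : Prop :=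
  IsKleinian Γ ∧ ∃ (v : E3) (c : ℝ), ‖v‖ = 1 ∧ |c| < 1 ∧
    (∀ γ ∈ Γ, (fun q : S2 => γ • q) '' roundDisk v c = roundDisk v c) ∧
    limitSet Γ = roundCircle v c

/-- A homeomorphism is quasiconformal if its linear dilatation
`limsup_{r → 0} (sup {d(Φ x, Φ y) : d(x, y) ≤ r} / inf {d(Φ x, Φ z) : d(x, z) ≥ r})`
is bounded uniformly in `x`. -/
def IsQuasiconformal (Φ : S2 ≃ₜ S2) : Prop :=
  ∃ H : ℝ, ∀ x : S2, ∀ᶠ r in 𝓝[>] (0 : ℝ), ∀ y z : S2,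
    dist x y ≤ r → r ≤ dist x z → dist (Φ x) (Φ y) ≤ H * dist (Φ x) (Φ z)

/-- A Kleinian group `Γ` is quasi-Fuchsian if `Γ = Φ⁻¹ ∘ Γ' ∘ Φ`, as groups of transformations of
the sphere, for a Fuchsian group `Γ'` of the first type and a quasiconformal `Φ`. -/
def IsQuasiFuchsian (Γ : Subgroup PSL(2, ℂ)) : Prop :=
  IsKleinian Γ ∧ ∃ (Γ' : Subgroup PSL(2, ℂ)) (Φ : S2 ≃ₜ S2),
    IsFuchsianFirstType Γ' ∧ IsQuasiconformal Φ ∧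
    (∀ γ ∈ Γ, ∃ γ' ∈ Γ', ∀ q : S2, γ • q = Φ.symm (γ' • Φ q)) ∧
    (∀ γ' ∈ Γ', ∃ γ ∈ Γ, ∀ q : S2, γ • q = Φ.symm (γ' • Φ q))

/-- A smooth surface is orientable if it is covered by smooth charts whose transition maps have
positive Jacobian determinant. -/
def IsOrientableSurface (S : Type) [TopologicalSpace S]
    [ChartedSpace (EuclideanSpace ℝ (Fin 2)) S] : Prop :=
  ∃ A ⊆ IsManifold.maximalAtlas (𝓡 2) ∞ S,
    (∀ x : S, ∃ φ ∈ A, x ∈ φ.source) ∧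
    ∀ φ ∈ A, ∀ ψ ∈ A, ∀ y ∈ (φ.symm.trans ψ).source, 0 < (fderiv ℝ (φ.symm.trans ψ) y).det

/-- Twice the genus of a compact connected orientable surface: its first Betti number, the rank of
the abelianized fundamental group. -/
def bettiOne (S : Type) [TopologicalSpace S] (s : S) : ℕ :=
  Module.finrank ℤ (Additive (Abelianization (FundamentalGroup S s)))

/-- `Γ` is isomorphic to the fundamental group of a compact connected oriented surface of genus
at least `2`. -/
def IsSurfaceGroup (Γ : Subgroup PSL(2, ℂ)) : Prop :=
  ∃ (S : Type) (_ : TopologicalSpace S) (_ : ChartedSpace (EuclideanSpace ℝ (Fin 2)) S)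
    (_ : IsManifold (𝓡 2) ∞ S) (_ : CompactSpace S) (_ : ConnectedSpace S) (_ : T2Space S) (s : S),
    IsOrientableSurface S ∧ 2 * 2 ≤ bettiOne S s ∧ Nonempty (Γ ≃* FundamentalGroup S s)

/-- Quasi-Fuchsian groups of Bers type. -/
def IsBersType (Γ : Subgroup PSL(2, ℂ)) : Prop := IsQuasiFuchsian Γ ∧ IsSurfaceGroup Γ

/-! ### The compactified quotient and its tunnel-vision function -/

/-- `D³ - Λ(Γ)`, as a subset of Euclidean space. -/
def domain (Γ : Subgroup PSL(2, ℂ)) : Set E3 :=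
  {x | ‖x‖ ≤ 1 ∧ ∀ q ∈ limitSet Γ, q.1 ≠ x}

/-- Two points of `D³ - Λ(Γ)` are equivalent if they lie in the same orbit of `Γ`. -/
def orbitSetoid (Γ : Subgroup PSL(2, ℂ)) : Setoid (domain Γ) :=
  (MulAction.orbitRel Γ D3).comap (fun x : domain Γ => (⟨x.1, x.2.1⟩ : D3))

/-- The `3`-manifold-with-boundary `X̄ = (D³ - Λ(Γ)) / Γ`, with the quotient topology. -/
abbrev Xbar (Γ : Subgroup PSL(2, ℂ)) : Type := Quotient (orbitSetoid Γ)

/-- The boundary `∂X̄ = (S² - Λ(Γ)) / Γ`. -/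
def bdry (Γ : Subgroup PSL(2, ℂ)) : Set (Xbar Γ) :=
  {p | ∃ x : domain Γ, ‖x.1‖ = 1 ∧ Quotient.mk (orbitSetoid Γ) x = p}

/-- `∂X̄` is the union of its two distinct connected components `Σ₊` and `Σ₋`. -/
structure IsBoundaryPair (Γ : Subgroup PSL(2, ℂ)) (Sp Sm : Set (Xbar Γ)) : Prop where
  comp_pos : ∃ p ∈ bdry Γ, Sp = connectedComponentIn (bdry Γ) p
  comp_neg : ∃ p ∈ bdry Γ, Sm = connectedComponentIn (bdry Γ) p
  ne : Sp ≠ Sm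
  union : Sp ∪ Sm = bdry Γ

open Classical in
/-- The pull-back of a function on `X̄` to `D³ - Λ(Γ)` (extended by zero to `ℝ³`). -/
def pullback {Γ : Subgroup PSL(2, ℂ)} (f : Xbar Γ → ℝ) (x : E3) : ℝ :=
  if hx : x ∈ domain Γ then f (Quotient.mk (orbitSetoid Γ) ⟨x, hx⟩) else 0

/-- The Laplace–Beltrami operator of the hyperbolic metric `ρ² |dx|²`, `ρ = 2 / (1 - |x|²)`, on the
unit ball of `ℝ³`: `ρ⁻³ div (ρ ∇F) = ρ⁻² ΔF + ρ⁻¹ ⟨x, ∇F⟩`, as `∇ρ = ρ² x`. -/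
def hypLaplacian (F : E3 → ℝ) (x : E3) : ℝ :=
  ((1 - ‖x‖ ^ 2) / 2) ^ 2 * Laplacian.laplacian F x + (1 - ‖x‖ ^ 2) / 2 * fderiv ℝ F x x

/-- `F` is a harmonic function on `ℋ³`. -/
def IsHypHarmonic (F : E3 → ℝ) : Prop :=
  ContDiffOn ℝ 2 F (Metric.ball 0 1) ∧ ∀ x ∈ Metric.ball (0 : E3) 1, hypLaplacian F x = 0

/-- `f` is the tunnel-vision function of `X = ℋ³ / Γ`: it is continuous on `X̄` with values in
`[0, 1]`, harmonic on `X`, equal to `1` on `Σ₊` and to `0` on `Σ₋`. -/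
structure IsTunnelVision (Γ : Subgroup PSL(2, ℂ)) (Sp Sm : Set (Xbar Γ)) (f : Xbar Γ → ℝ) :
    Prop where
  continuous : Continuous f
  mem_Icc : ∀ p, f p ∈ Set.Icc (0 : ℝ) 1
  harmonic : IsHypHarmonic (pullback f)
  eq_one : ∀ p ∈ Sp, f p = 1
  eq_zero : ∀ p ∈ Sm, f p = 0

/-- A `C²` curve `c : [0, ε] → D³ - Λ(Γ)` that starts at the boundary point `q` in the direction of
the inward normal `-q`.  The metrics on `X̄` in the conformal class `[h̄]` all have this normal
direction, and their geodesics normal to the boundary lift to such curves. -/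
structure IsNormalCurve (Γ : Subgroup PSL(2, ℂ)) (q : E3) (ε : ℝ) (c : ℝ → E3) : Prop where
  pos : 0 < ε
  contDiffOn : ContDiffOn ℝ 2 c (Set.Icc 0 ε)
  mapsTo : Set.MapsTo c (Set.Icc 0 ε) (domain Γ)
  start : c 0 = q
  normal : ∃ l : ℝ, 0 < l ∧ derivWithin c (Set.Icc 0 ε) 0 = -(l • q)

end QuasiFuchsian

end

noncomputable section
namespace QuasiFuchsian
open Laplacian InnerProductSpace MeasureTheory Filter Set Metric

/-! The key point is local: if a harmonic function `G` with values in `[0, 1]` vanishes on the part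
of the sphere near a boundary point `q` and is not identically zero, then `G = (1 - |x|²)² H` with
`H` of class `C²` near `q` and `H q > 0` (`exists_factor`). On the sphere the tunnel-vision function
takes only the values `0` and `1`, so by continuity it is constant there near `q`. The factorization
then applies to the function itself or to its difference from `1`. Along a normal curve `1 - |c|²`
has a simple zero with derivative `2l`, so the function is `κ` plus its square times a nonvanishing
factor. The first derivative is therefore zero, and the second is `8 l²` times that factor, up to
sign.

The factorization is what the Poisson formula gives: the kernel is a multiple of `(1 - |x|²)² / |x -
ξ|⁴`, and only boundary points `ξ` away from `q` contribute. The formula is reached through averages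
over the interior. Let `t` be the hyperbolic secant of the distance to `x`. Green's identity applied
to `t ^ a`, `a > 2`, relates the integrals of `G t ^ a` and `G t ^ (a + 2)` by a factor independent
of `G` (`moment_recurrence`). The `t ^ a`-weighted mean of `G` is thus unchanged under `a ↦ a + 2`;
for large exponents the weight peaks at `x`, so the mean is `G x` (`mean_value`). The total weight
does not depend on `x` (`integral_weight_eq`), whence `G x` is `(1 - |x|²) ^ a` times an integral of
`kerDen x y ^ (-a)`.

Finally let `a` decrease to `2`. The total weight blows up, so the normalized densities concentrate
on the sphere, and no mass survives near `q`, where `G` vanishes (`tendsto_mass_near`). A weak-*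
limit point of the densities away from `q` is a positive functional that represents `H`. -/

/-! ### Partial derivatives and Green's identity for the hyperbolic Laplacian -/

/-- The partial derivative of `F` in the direction of the `i`-th coordinate. -/
def pd (i : Fin 3) (F : E3 → ℝ) (x : E3) : ℝ := fderiv ℝ F x (EuclideanSpace.single i 1)

lemma contDiffAt_pd {F : E3 → ℝ} {x : E3} (h : ContDiffAt ℝ 2 F x) (i : Fin 3) :
    ContDiffAt ℝ 1 (pd i F) x :=
  (h.fderiv_right (m := 1) (by norm_num)).clm_apply contDiffAt_const

lemma laplacian_eq_sum_pd {F : E3 → ℝ} {x : E3} (h : ContDiffAt ℝ 2 F x) :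
    Laplacian.laplacian F x = ∑ i, pd i (pd i F) x := by
  rw [laplacian_eq_iteratedFDeriv_orthonormalBasis F (EuclideanSpace.basisFun (Fin 3) ℝ)]
  refine Finset.sum_congr rfl fun i _ => ?_
  have h1 : DifferentiableAt ℝ (fderiv ℝ F) x :=
    (h.fderiv_right (m := 1) (by norm_num)).differentiableAt (by norm_num)
  have : pd i F = fun z => fderiv ℝ F z (EuclideanSpace.single i 1) := rfl
  rw [iteratedFDeriv_two_apply, pd, this, fderiv_clm_apply h1 (by fun_prop)]
  simp

lemma eq_sum_single (y : E3) : y = ∑ i, y i • EuclideanSpace.single i (1 : ℝ) := by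
  ext j; simp [Finset.sum_apply, Pi.single_apply]

lemma fderiv_apply_eq_sum_pd (F : E3 → ℝ) (x y : E3) : fderiv ℝ F x y = ∑ i, y i * pd i F x := by
  conv_lhs => rw [eq_sum_single y]
  simp [pd]

/-- The conformal factor `ρ = 2 / (1 - |x|²)` of the hyperbolic metric. -/
def conf (y : E3) : ℝ := 2 / (1 - ‖y‖ ^ 2)

lemma one_sub_norm_sq_pos {y : E3} (hy : ‖y‖ < 1) : 0 < 1 - ‖y‖ ^ 2 := by
  nlinarith [norm_nonneg y]

lemma conf_pos {y : E3} (hy : ‖y‖ < 1) : 0 < conf y :=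
  div_pos two_pos (one_sub_norm_sq_pos hy)

lemma contDiffAt_conf {y : E3} (hy : ‖y‖ < 1) : ContDiffAt ℝ 2 conf y :=
  contDiffAt_const.div (contDiffAt_const.sub (contDiff_norm_sq ℝ).contDiffAt)
    (one_sub_norm_sq_pos hy).ne'

lemma pd_norm_sq (i : Fin 3) (y : E3) : pd i (fun z => ‖z‖ ^ 2) y = 2 * y i := by
  rw [pd, fderiv_norm_sq]
  simp [EuclideanSpace.inner_single_right]

lemma pd_mul {F G : E3 → ℝ} {y : E3} (hF : DifferentiableAt ℝ F y) (hG : DifferentiableAt ℝ G y)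
    (i : Fin 3) : pd i (fun z => F z * G z) y = pd i F y * G y + F y * pd i G y := by
  simp only [pd]
  rw [fderiv_fun_mul hF hG]
  simp
  ring

lemma pd_sub {F G : E3 → ℝ} {y : E3} (hF : DifferentiableAt ℝ F y) (hG : DifferentiableAt ℝ G y)
    (i : Fin 3) : pd i (fun z => F z - G z) y = pd i F y - pd i G y := by
  simp only [pd]
  rw [fderiv_fun_sub hF hG]
  simp

lemma pd_comp {ψ : ℝ → ℝ} {F : E3 → ℝ} {y : E3} (hψ : DifferentiableAt ℝ ψ (F y))
    (hF : DifferentiableAt ℝ F y) (i : Fin 3) :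
    pd i (fun z => ψ (F z)) y = deriv ψ (F y) * pd i F y := by
  have := (hψ.hasDerivAt.comp_hasFDerivAt y hF.hasFDerivAt).fderiv
  simp only [pd]
  rw [show (fun z => ψ (F z)) = ψ ∘ F from rfl, this]
  simp

lemma pd_conf {y : E3} (hy : ‖y‖ < 1) (i : Fin 3) : pd i conf y = conf y ^ 2 * y i := by
  have h0 := (one_sub_norm_sq_pos hy).ne'
  have hd : HasDerivAt (fun s : ℝ => 2 / (1 - s)) (2 / (1 - ‖y‖ ^ 2) ^ 2) (‖y‖ ^ 2) := by
    have := ((hasDerivAt_const (‖y‖ ^ 2) (2 : ℝ)).fun_div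
      ((hasDerivAt_id (‖y‖ ^ 2)).const_sub 1) h0)
    simpa using this
  have := pd_comp (ψ := fun s : ℝ => 2 / (1 - s)) (F := fun z : E3 => ‖z‖ ^ 2)
    hd.differentiableAt (contDiff_norm_sq ℝ (n := 1)).differentiable_one.differentiableAt i
  rw [hd.deriv, pd_norm_sq] at this
  rw [show conf = fun z : E3 => 2 / (1 - ‖z‖ ^ 2) from rfl, this]
  field_simp

/-- The divergence form `div (ρ ∇F) = ρ³ ΔF` of the hyperbolic Laplacian. -/
lemma sum_pd_conf_mul_pd {F : E3 → ℝ} {y : E3} (hy : ‖y‖ < 1) (h : ContDiffAt ℝ 2 F y) :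
    ∑ i, pd i (fun z => conf z * pd i F z) y = conf y ^ 3 * hypLaplacian F y := by
  have hc : DifferentiableAt ℝ conf y := (contDiffAt_conf hy).differentiableAt (by norm_num)
  have hF := fun i => (contDiffAt_pd h i).differentiableAt (by norm_num)
  have hcy : (1 - ‖y‖ ^ 2) / 2 = (conf y)⁻¹ := by rw [conf, inv_div]
  have := (conf_pos hy).ne'
  rw [hypLaplacian, laplacian_eq_sum_pd h, fderiv_apply_eq_sum_pd, hcy]
  simp only [pd_mul hc (hF _), pd_conf hy, Fin.sum_univ_three]
  field_simp
  ring

lemma pd_eq_zero_of_notMem_tsupport {V : E3 → ℝ} {i : Fin 3} {y : E3} (hy : y ∉ tsupport V) :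
    pd i V y = 0 := by
  rw [pd, (notMem_tsupport_iff_eventuallyEq.1 hy).fderiv_eq]
  simp

lemma integral_pd_eq_zero {V : E3 → ℝ} (hV : ContDiff ℝ 1 V) (hc : HasCompactSupport V)
    (i : Fin 3) : Integrable (pd i V) ∧ ∫ y, pd i V y = 0 := by
  have hi : Integrable (pd i V) := by
    refine Continuous.integrable_of_hasCompactSupport ?_ ?_
    · exact (hV.continuous_fderiv (by norm_num)).clm_apply continuous_const
    · exact hc.fderiv_apply ℝ _
  refine ⟨hi, ?_⟩
  -- Integration by parts against the constant function `1`.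
  have := integral_mul_fderiv_eq_neg_fderiv_mul_of_integrable (μ := (volume : Measure E3))
    (f := fun _ : E3 => (1 : ℝ)) (g := V) (v := EuclideanSpace.single i (1 : ℝ))
    (by simp) (by simpa [pd] using! hi)
    (by simpa using hV.continuous.integrable_of_hasCompactSupport hc) (by simp)
    (fun x _ => (hV.differentiable (by norm_num)) x)
  simpa [pd] using! this

/-- Green's identity for the hyperbolic Laplacian, against a harmonic function. -/
lemma integral_mul_hypLaplacian_eq_zero {G Φ : E3 → ℝ} (hG : IsHypHarmonic G)
    (hΦ : ContDiff ℝ 2 Φ) (hs : tsupport Φ ⊆ ball 0 1) :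
    ∫ y in ball (0 : E3) 1, G y * (conf y ^ 3 * hypLaplacian Φ y) = 0 := by
  -- The field `ρ (G ∇Φ - Φ ∇G)`, whose divergence is `ρ³ (G ΔΦ - Φ ΔG)` with `Δ` the hyperbolic
  -- Laplacian.
  set V : Fin 3 → E3 → ℝ := fun i z => G z * (conf z * pd i Φ z) - Φ z * (conf z * pd i G z)
    with hVdef
  have hVs : ∀ i, tsupport (V i) ⊆ tsupport Φ := by
    intro i
    refine closure_minimal ?_ (isClosed_tsupport Φ)
    intro y hy
    by_contra h
    refine hy ?_
    simp [hVdef, pd_eq_zero_of_notMem_tsupport h, image_eq_zero_of_notMem_tsupport h]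
  have hGy : ∀ y ∈ ball (0 : E3) 1, ContDiffAt ℝ 2 G y := fun y hy =>
    hG.1.contDiffAt (isOpen_ball.mem_nhds hy)
  have hcΦ : HasCompactSupport Φ :=
    HasCompactSupport.intro' ((isCompact_closedBall (0 : E3) 1).of_isClosed_subset
      (isClosed_tsupport Φ) (hs.trans ball_subset_closedBall)) (isClosed_tsupport Φ)
      fun x hx => image_eq_zero_of_notMem_tsupport hx
  -- Neither `G` nor `conf` is controlled outside the ball, but the support of `V` stays inside it.
  have hV1 : ∀ i, ContDiff ℝ 1 (V i) := by
    intro i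
    refine contDiff_iff_contDiffAt.2 fun y => ?_
    by_cases hy : y ∈ tsupport (V i)
    swap
    · exact contDiffAt_const.congr_of_eventuallyEq (notMem_tsupport_iff_eventuallyEq.1 hy)
    have hyb := hs (hVs i hy)
    have hy1 : ‖y‖ < 1 := by simpa using hyb
    have c1 := (contDiffAt_conf hy1).of_le (show (1 : WithTop ℕ∞) ≤ 2 by norm_num)
    exact ((((hGy y hyb).of_le (by norm_num)).mul (c1.mul (contDiffAt_pd hΦ.contDiffAt i)))).sub
      ((hΦ.contDiffAt.of_le (by norm_num)).mul (c1.mul (contDiffAt_pd (hGy y hyb) i)))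
  have hVc : ∀ i, HasCompactSupport (V i) := fun i =>
    hcΦ.isCompact.of_isClosed_subset (isClosed_tsupport _) (hVs i)
  have hdiv : ∀ y ∈ ball (0 : E3) 1,
      ∑ i, pd i (V i) y = G y * (conf y ^ 3 * hypLaplacian Φ y) := by
    intro y hyb
    have hy1 : ‖y‖ < 1 := by simpa using hyb
    have hc : DifferentiableAt ℝ conf y := (contDiffAt_conf hy1).differentiableAt (by norm_num)
    have hGd := (hGy y hyb).differentiableAt (n := 2) (by norm_num)
    have hΦd := hΦ.contDiffAt (x := y) |>.differentiableAt (n := 2) (by norm_num)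
    have dG := fun i => hc.fun_mul ((contDiffAt_pd (hGy y hyb) i).differentiableAt (by norm_num))
    have dΦ := fun i => hc.fun_mul
      ((contDiffAt_pd (hΦ.contDiffAt (x := y)) i).differentiableAt (by norm_num))
    have e : ∀ i, pd i (V i) y = G y * pd i (fun z => conf z * pd i Φ z) y
        - Φ y * pd i (fun z => conf z * pd i G z) y := by
      intro i
      rw [hVdef]
      simp only
      rw [pd_sub (hGd.fun_mul (dΦ i)) (hΦd.fun_mul (dG i)), pd_mul hGd (dΦ i), pd_mul hΦd (dG i)]
      ring
    simp only [e, Finset.sum_sub_distrib, ← Finset.mul_sum]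
    rw [sum_pd_conf_mul_pd hy1 (hGy y hyb), sum_pd_conf_mul_pd hy1 hΦ.contDiffAt, hG.2 y hyb]
    ring
  rw [← setIntegral_congr_fun measurableSet_ball hdiv, setIntegral_eq_integral_of_forall_compl_eq_zero]
  · rw [integral_finsetSum _ fun i _ => (integral_pd_eq_zero (hV1 i) (hVc i) i).1]
    exact Finset.sum_eq_zero fun i _ => (integral_pd_eq_zero (hV1 i) (hVc i) i).2
  · intro y hy
    exact Finset.sum_eq_zero fun i _ =>
      pd_eq_zero_of_notMem_tsupport fun h => hy (hs (hVs i h))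

/-! ### The hyperbolic secant of the distance and its Laplacian -/

/-- The denominator of `sechDist`. -/
def kerDen (x y : E3) : ℝ := (1 + ‖x‖ ^ 2) * (1 + ‖y‖ ^ 2) - 4 * inner ℝ x y

/-- The hyperbolic secant of the hyperbolic distance of `x` and `y`. -/
def sechDist (x y : E3) : ℝ := (1 - ‖x‖ ^ 2) * (1 - ‖y‖ ^ 2) / kerDen x y

/-- This form matches `cosh d = 1 + 2 |x - y|² / ((1 - |x|²) (1 - |y|²))`, and shows that on the
sphere `kerDen` reduces to `2 |x - y|²`, the denominator of the Poisson kernel. -/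
lemma kerDen_eq (x y : E3) :
    kerDen x y = (1 - ‖x‖ ^ 2) * (1 - ‖y‖ ^ 2) + 2 * ‖x - y‖ ^ 2 := by
  rw [kerDen, norm_sub_sq_real]; ring

lemma kerDen_pos {x : E3} (hx : ‖x‖ < 1) (y : E3) : 0 < kerDen x y := by
  have h := real_inner_le_norm x y
  have h1 : 4 * (‖x‖ * ‖y‖) ≤ 2 * ‖x‖ * (1 + ‖y‖ ^ 2) := by
    nlinarith [norm_nonneg x, norm_nonneg y, sq_nonneg (1 - ‖y‖),
      mul_nonneg (norm_nonneg x) (sq_nonneg (1 - ‖y‖))]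
  have h2 : 0 < (1 - ‖x‖) ^ 2 * (1 + ‖y‖ ^ 2) := by
    have : 0 < 1 - ‖x‖ := by linarith
    positivity
  rw [kerDen]; nlinarith

lemma contDiff_kerDen (x : E3) : ContDiff ℝ 2 (kerDen x) :=
  (contDiff_const.mul (contDiff_const.add (contDiff_norm_sq ℝ))).sub
    (contDiff_const.mul (contDiff_const.inner ℝ contDiff_id))

/-- The reason to work with the secant instead of the distance: it is a rational function with no
singularity at `x` or at the sphere. -/
lemma contDiff_sechDist {x : E3} (hx : ‖x‖ < 1) : ContDiff ℝ 2 (sechDist x) :=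
  (contDiff_const.mul (contDiff_const.sub (contDiff_norm_sq ℝ))).div (contDiff_kerDen x)
    fun y => (kerDen_pos hx y).ne'

lemma pd_add {F G : E3 → ℝ} {y : E3} (hF : DifferentiableAt ℝ F y) (hG : DifferentiableAt ℝ G y)
    (i : Fin 3) : pd i (fun z => F z + G z) y = pd i F y + pd i G y := by
  simp only [pd]
  rw [fderiv_fun_add hF hG]
  simp

lemma pd_const (c : ℝ) (i : Fin 3) (y : E3) : pd i (fun _ => c) y = 0 := by simp [pd]

lemma pd_inner (x : E3) (i : Fin 3) (y : E3) : pd i (fun z => inner ℝ x z) y = x i := by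
  rw [pd]
  have : HasFDerivAt (fun z : E3 => inner ℝ x z) (innerSL ℝ x) y := (innerSL ℝ x).hasFDerivAt
  rw [this.fderiv]
  simp [EuclideanSpace.inner_single_right]

lemma pd_coord (i : Fin 3) (y : E3) : pd i (fun z => z i) y = 1 := by
  rw [pd]
  have : HasFDerivAt (fun z : E3 => z i) (EuclideanSpace.proj i : E3 →L[ℝ] ℝ) y :=
    (EuclideanSpace.proj i : E3 →L[ℝ] ℝ).hasFDerivAt
  rw [this.fderiv]
  simp

lemma differentiableAt_coord (i : Fin 3) (y : E3) : DifferentiableAt ℝ (fun z : E3 => z i) y :=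
  (EuclideanSpace.proj i : E3 →L[ℝ] ℝ).differentiableAt

lemma differentiableAt_norm_sq (y : E3) : DifferentiableAt ℝ (fun z : E3 => ‖z‖ ^ 2) y :=
  (contDiff_norm_sq ℝ (n := 1)).differentiable (by norm_num) y

lemma pd_kerDen (x y : E3) (i : Fin 3) :
    pd i (kerDen x) y = 2 * (1 + ‖x‖ ^ 2) * y i - 4 * x i := by
  have h1 := differentiableAt_norm_sq y
  have h2 : DifferentiableAt ℝ (fun z : E3 => inner ℝ x z) y :=
    (innerSL ℝ x).differentiableAt
  rw [show kerDen x = fun z => (1 + ‖x‖ ^ 2) * (1 + ‖z‖ ^ 2) - 4 * inner ℝ x z from rfl,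
    pd_sub (by fun_prop) (by fun_prop), pd_mul (by fun_prop) (by fun_prop),
    pd_mul (by fun_prop) (by fun_prop), pd_add (by fun_prop) h1, pd_norm_sq, pd_inner]
  simp only [pd_const]
  ring

/-- The numerator of the partial derivatives of `sechDist x`. -/
def sechNum (x : E3) (i : Fin 3) (y : E3) : ℝ :=
  (1 - ‖y‖ ^ 2) * x i - y i * (1 + ‖x‖ ^ 2 - 2 * inner ℝ x y)

lemma pd_inv_pow {F : E3 → ℝ} {y : E3} (hF : DifferentiableAt ℝ F y) (h0 : F y ≠ 0) (n : ℕ)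
    (i : Fin 3) : pd i (fun z => (F z ^ n)⁻¹) y = -n * (F y ^ (n + 1))⁻¹ * pd i F y := by
  have hd : HasDerivAt (fun s : ℝ => (s ^ n)⁻¹) (-n * (F y ^ (n + 1))⁻¹) (F y) := by
    have := (hasDerivAt_pow n (F y)).inv (pow_ne_zero n h0)
    refine this.congr_deriv ?_
    rcases n with _ | n
    · simp
    · field_simp
      rw [Nat.add_sub_cancel]
      ring
  rw [pd_comp (ψ := fun s : ℝ => (s ^ n)⁻¹) hd.differentiableAt hF, hd.deriv]

lemma pd_sechDist {x : E3} (hx : ‖x‖ < 1) (y : E3) (i : Fin 3) :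
    pd i (sechDist x) y = 4 * (1 - ‖x‖ ^ 2) * (sechNum x i y * (kerDen x y ^ 2)⁻¹) := by
  have h1 := differentiableAt_norm_sq y
  have hk := (contDiff_kerDen x).differentiable (by norm_num) y
  have hp := (kerDen_pos hx y).ne'
  have hi : DifferentiableAt ℝ (fun z => (kerDen x z ^ 1)⁻¹) y :=
    (hk.pow 1).inv (pow_ne_zero _ hp)
  have e : sechDist x = fun z => (1 - ‖x‖ ^ 2) * (1 - ‖z‖ ^ 2) * (kerDen x z ^ 1)⁻¹ := by
    ext z; simp [sechDist, div_eq_mul_inv]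
  rw [e, pd_mul (by fun_prop) hi, pd_inv_pow hk hp, pd_mul (by fun_prop) (by fun_prop),
    pd_sub (by fun_prop) h1, pd_norm_sq, pd_kerDen, pd_const, pd_const, sechNum]
  have hk' : kerDen x y = (1 + ‖x‖ ^ 2) * (1 + ‖y‖ ^ 2) - 4 * inner ℝ x y := rfl
  field_simp
  rw [hk']
  push_cast
  ring

lemma pd_sechNum (x y : E3) (i : Fin 3) :
    pd i (sechNum x i) y = -(1 + ‖x‖ ^ 2 - 2 * inner ℝ x y) := by
  have h1 := differentiableAt_norm_sq y
  have h2 : DifferentiableAt ℝ (fun z : E3 => inner ℝ x z) y :=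
    (innerSL ℝ x).differentiableAt
  have h3 := differentiableAt_coord i y
  rw [show sechNum x i = fun z => (1 - ‖z‖ ^ 2) * x i - z i * (1 + ‖x‖ ^ 2 - 2 * inner ℝ x z)
    from rfl, pd_sub (by fun_prop) (h3.fun_mul (by fun_prop)), pd_mul (by fun_prop) (by fun_prop),
    pd_mul h3 (by fun_prop), pd_sub (by fun_prop) h1, pd_sub (by fun_prop) (by fun_prop),
    pd_mul (by fun_prop) h2, pd_coord, pd_norm_sq, pd_inner]
  simp only [pd_const]
  ring

lemma differentiableAt_sechNum (x y : E3) (i : Fin 3) : DifferentiableAt ℝ (sechNum x i) y := by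
  have h1 := differentiableAt_norm_sq y
  have h2 : DifferentiableAt ℝ (fun z : E3 => inner ℝ x z) y :=
    (innerSL ℝ x).differentiableAt
  have h3 := differentiableAt_coord i y
  exact ((h1.const_sub 1).mul_const (x i)).sub (h3.fun_mul (by fun_prop))

lemma pd_pd_sechDist {x : E3} (hx : ‖x‖ < 1) (y : E3) (i : Fin 3) :
    pd i (pd i (sechDist x)) y = 4 * (1 - ‖x‖ ^ 2) *
      (-(1 + ‖x‖ ^ 2 - 2 * inner ℝ x y) * (kerDen x y ^ 2)⁻¹
        - 2 * sechNum x i y * (kerDen x y ^ 3)⁻¹ * (2 * (1 + ‖x‖ ^ 2) * y i - 4 * x i)) := by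
  have hk := (contDiff_kerDen x).differentiable (by norm_num) y
  have hp := (kerDen_pos hx y).ne'
  have hi : DifferentiableAt ℝ (fun z => (kerDen x z ^ 2)⁻¹) y :=
    (hk.pow 2).inv (pow_ne_zero _ hp)
  have hn := differentiableAt_sechNum x y i
  rw [funext fun z => pd_sechDist hx z i, pd_mul (by fun_prop) (hn.fun_mul hi), pd_const,
    pd_mul hn hi, pd_inv_pow hk hp, pd_sechNum, pd_kerDen]
  push_cast
  ring

lemma inner_E3 (x y : E3) : inner ℝ x y = x 0 * y 0 + x 1 * y 1 + x 2 * y 2 := by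
  rw [PiLp.inner_apply, Fin.sum_univ_three]
  simp
  ring

/-- The squared hyperbolic gradient of `t = sech r` is `(sech r tanh r)² = t² (1 - t²)`; here it is
checked in coordinates. -/
lemma norm_grad_sechDist {x : E3} (hx : ‖x‖ < 1) (y : E3) :
    ((1 - ‖y‖ ^ 2) / 2) ^ 2 * ∑ i, pd i (sechDist x) y ^ 2
      = sechDist x y ^ 2 - sechDist x y ^ 4 := by
  have hp := (kerDen_pos hx y).ne'
  have s : ∑ i, sechNum x i y ^ 2 = (1 - ‖y‖ ^ 2) ^ 2 * ‖x‖ ^ 2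
      - 2 * (1 - ‖y‖ ^ 2) * (1 + ‖x‖ ^ 2 - 2 * inner ℝ x y) * inner ℝ x y
      + (1 + ‖x‖ ^ 2 - 2 * inner ℝ x y) ^ 2 * ‖y‖ ^ 2 := by
    simp only [sechNum, Fin.sum_univ_three]
    generalize 1 + ‖x‖ ^ 2 - 2 * inner ℝ x y = m
    generalize 1 - ‖y‖ ^ 2 = n
    rw [norm_sq_E3, norm_sq_E3, inner_E3]
    ring
  have e : ∑ i, pd i (sechDist x) y ^ 2
      = (4 * (1 - ‖x‖ ^ 2)) ^ 2 * ((kerDen x y ^ 2)⁻¹) ^ 2 * ∑ i, sechNum x i y ^ 2 := by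
    rw [Finset.mul_sum]
    refine Finset.sum_congr rfl fun i _ => ?_
    rw [pd_sechDist hx]
    ring
  have hk' : inner ℝ x y = ((1 + ‖x‖ ^ 2) * (1 + ‖y‖ ^ 2) - kerDen x y) / 4 := by
    rw [kerDen]; ring
  rw [e, s, sechDist, hk']
  generalize kerDen x y = Q at *
  field_simp
  ring

/-- For radial functions the Laplacian is `∂ᵣ² + 2 coth r ∂ᵣ`, and `sech r` gives `(t - 2 t³) - 2
t`. -/
lemma hypLaplacian_sechDist {x : E3} (hx : ‖x‖ < 1) (y : E3) :
    ((1 - ‖y‖ ^ 2) / 2) ^ 2 * ∑ i, pd i (pd i (sechDist x)) y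
      + (1 - ‖y‖ ^ 2) / 2 * ∑ i, y i * pd i (sechDist x) y
      = -(sechDist x y + 2 * sechDist x y ^ 3) := by
  have hp := (kerDen_pos hx y).ne'
  have s1 : ∑ i, y i * sechNum x i y = (1 - ‖y‖ ^ 2) * inner ℝ x y
      - ‖y‖ ^ 2 * (1 + ‖x‖ ^ 2 - 2 * inner ℝ x y) := by
    simp only [sechNum, Fin.sum_univ_three]
    generalize 1 + ‖x‖ ^ 2 - 2 * inner ℝ x y = m
    generalize 1 - ‖y‖ ^ 2 = n
    rw [norm_sq_E3, inner_E3]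
    ring
  have s2 : ∑ i, x i * sechNum x i y = (1 - ‖y‖ ^ 2) * ‖x‖ ^ 2
      - inner ℝ x y * (1 + ‖x‖ ^ 2 - 2 * inner ℝ x y) := by
    simp only [sechNum, Fin.sum_univ_three]
    generalize 1 + ‖x‖ ^ 2 - 2 * inner ℝ x y = m
    generalize 1 - ‖y‖ ^ 2 = n
    rw [norm_sq_E3, inner_E3]
    ring
  have e1 : ∑ i, y i * pd i (sechDist x) y
      = 4 * (1 - ‖x‖ ^ 2) * (kerDen x y ^ 2)⁻¹ * ∑ i, y i * sechNum x i y := by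
    rw [Finset.mul_sum]
    refine Finset.sum_congr rfl fun i _ => ?_
    rw [pd_sechDist hx]
    ring
  have e2 : ∑ i, pd i (pd i (sechDist x)) y = 4 * (1 - ‖x‖ ^ 2) *
      (-3 * (1 + ‖x‖ ^ 2 - 2 * inner ℝ x y) * (kerDen x y ^ 2)⁻¹
        - 2 * (kerDen x y ^ 3)⁻¹ * (2 * (1 + ‖x‖ ^ 2) * ∑ i, y i * sechNum x i y
          - 4 * ∑ i, x i * sechNum x i y)) := by
    simp only [pd_pd_sechDist hx, Fin.sum_univ_three]
    ring
  have hk' : inner ℝ x y = ((1 + ‖x‖ ^ 2) * (1 + ‖y‖ ^ 2) - kerDen x y) / 4 := by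
    rw [kerDen]; ring
  rw [e1, e2, s1, s2, sechDist, hk']
  generalize kerDen x y = Q at *
  field_simp
  ring

lemma hypLaplacian_comp_sechDist {x : E3} (hx : ‖x‖ < 1) {ψ : ℝ → ℝ} (hψ : ContDiff ℝ 2 ψ)
    (y : E3) : hypLaplacian (fun z => ψ (sechDist x z)) y =
      (sechDist x y ^ 2 - sechDist x y ^ 4) * deriv (deriv ψ) (sechDist x y)
        - (sechDist x y + 2 * sechDist x y ^ 3) * deriv ψ (sechDist x y) := by
  have ht := contDiff_sechDist hx
  have hd : Differentiable ℝ ψ := hψ.differentiable (by norm_num)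
  have hd1 : ContDiff ℝ 1 (deriv ψ) :=
    (contDiff_succ_iff_deriv.1 (show ContDiff ℝ (1 + 1) ψ by norm_num; exact hψ)).2.2
  have hd2 : Differentiable ℝ (deriv ψ) := hd1.differentiable (by norm_num)
  have htd : Differentiable ℝ (sechDist x) := ht.differentiable (by norm_num)
  have htp := fun i => (contDiffAt_pd (ht.contDiffAt (x := y)) i).differentiableAt (by norm_num)
  have p1 : ∀ i z, pd i (fun z => ψ (sechDist x z)) z
      = deriv ψ (sechDist x z) * pd i (sechDist x) z := fun i z => pd_comp (hd _) (htd z) i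
  have p2 : ∀ i, pd i (pd i fun z => ψ (sechDist x z)) y
      = deriv (deriv ψ) (sechDist x y) * pd i (sechDist x) y ^ 2
        + deriv ψ (sechDist x y) * pd i (pd i (sechDist x)) y := by
    intro i
    rw [funext fun z => p1 i z, pd_mul ((hd2 _).fun_comp' y (htd y)) (htp i),
      pd_comp (hd2 _) (htd y)]
    ring
  rw [hypLaplacian, laplacian_eq_sum_pd (F := fun z => ψ (sechDist x z)) (hψ.comp ht).contDiffAt, fderiv_apply_eq_sum_pd]
  simp only [p1, p2, Finset.sum_add_distrib]
  have e : ∑ i, y i * (deriv ψ (sechDist x y) * pd i (sechDist x) y)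
      = deriv ψ (sechDist x y) * ∑ i, y i * pd i (sechDist x) y := by
    rw [Finset.mul_sum]
    exact Finset.sum_congr rfl fun i _ => by ring
  rw [e, ← Finset.mul_sum, ← Finset.mul_sum]
  linear_combination deriv (deriv ψ) (sechDist x y) * norm_grad_sechDist hx y
    + deriv ψ (sechDist x y) * hypLaplacian_sechDist hx y

/-! ### Truncated powers and integrability of the weights -/

lemma hasDerivAt_max_sub_rpow {a : ℝ} (ha : 1 < a) (e u : ℝ) :
    HasDerivAt (fun u : ℝ => max (u - e) 0 ^ a) (a * max (u - e) 0 ^ (a - 1)) u := by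
  refine hasDerivAt_of_hasDerivAt_of_ne' (x := e)
    (f := fun u : ℝ => max (u - e) 0 ^ a) (g := fun u => a * max (u - e) 0 ^ (a - 1)) ?_ ?_ ?_ u
  -- The formula is clear off the corner `u = e`; continuity of both sides extends it across.
  · intro y hy
    rcases lt_or_gt_of_ne hy with h | h
    · have : (fun u : ℝ => max (u - e) 0 ^ a) =ᶠ[𝓝 y] fun _ => 0 := by
        filter_upwards [Iio_mem_nhds h] with z hz
        rw [max_eq_right (by linarith [mem_Iio.1 hz]), Real.zero_rpow (by linarith)]
      rw [max_eq_right (by linarith), Real.zero_rpow (by linarith), mul_zero]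
      exact (hasDerivAt_const y (0 : ℝ)).congr_of_eventuallyEq this
    · have : (fun u : ℝ => max (u - e) 0 ^ a) =ᶠ[𝓝 y] fun z => (z - e) ^ a := by
        filter_upwards [Ioi_mem_nhds h] with z hz
        rw [max_eq_left (by linarith [mem_Ioi.1 hz])]
      rw [max_eq_left (by linarith)]
      refine HasDerivAt.congr_of_eventuallyEq ?_ this
      have := ((hasDerivAt_id y).sub_const e).rpow_const (p := a) (Or.inr ha.le)
      simpa using this
  · exact (Continuous.rpow_const (by fun_prop) fun _ => Or.inr (by linarith)).continuousAt
  · exact (continuous_const.mul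
      (Continuous.rpow_const (by fun_prop) fun _ => Or.inr (by linarith))).continuousAt

lemma deriv_max_sub_rpow {a : ℝ} (ha : 1 < a) (e : ℝ) :
    deriv (fun u : ℝ => max (u - e) 0 ^ a) = fun u => a * max (u - e) 0 ^ (a - 1) :=
  funext fun u => (hasDerivAt_max_sub_rpow ha e u).deriv

lemma deriv_deriv_max_sub_rpow {a : ℝ} (ha : 2 < a) (e : ℝ) :
    deriv (deriv fun u : ℝ => max (u - e) 0 ^ a)
      = fun u => a * (a - 1) * max (u - e) 0 ^ (a - 2) := by
  rw [deriv_max_sub_rpow (by linarith) e]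
  funext u
  rw [((hasDerivAt_max_sub_rpow (a := a - 1) (by linarith) e u).const_mul a).deriv]
  ring_nf

/-- For `e > 0`, composing with `sechDist x` gives a test function supported in a compact part of
the ball, which `sechDist x ^ a` is not. The condition `2 < a` keeps it `C²` at the cut. -/
lemma contDiff_max_sub_rpow {a : ℝ} (ha : 2 < a) (e : ℝ) :
    ContDiff ℝ 2 fun u : ℝ => max (u - e) 0 ^ a := by
  have h : ∀ b : ℝ, 1 < b → ContDiff ℝ 1 fun u : ℝ => max (u - e) 0 ^ b := by
    intro b hb
    rw [contDiff_one_iff_deriv]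
    refine ⟨fun u => (hasDerivAt_max_sub_rpow hb e u).differentiableAt, ?_⟩
    rw [deriv_max_sub_rpow hb]
    exact continuous_const.mul
      (Continuous.rpow_const (by fun_prop) fun _ => Or.inr (by linarith))
  rw [show (2 : WithTop ℕ∞) = 1 + 1 by norm_num, contDiff_succ_iff_deriv]
  refine ⟨fun u => (hasDerivAt_max_sub_rpow (by linarith) e u).differentiableAt, by simp, ?_⟩
  rw [deriv_max_sub_rpow (by linarith)]
  exact contDiff_const.mul (h _ (by linarith))

/-- In polar coordinates the only singular factor is `(1 - r) ^ b`. With `b = a - 3` this yields the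
threshold `a > 2` for the weights. -/
lemma integrableOn_one_sub_norm_sq_rpow {b : ℝ} (hb : -1 < b) :
    IntegrableOn (fun y : E3 => (1 - ‖y‖ ^ 2) ^ b) (ball 0 1) := by
  rw [integrableOn_fun_norm_addHaar (volume : Measure E3) (f := fun r : ℝ => (1 - r ^ 2) ^ b)]
  have h1 : IntegrableOn (fun r : ℝ => (1 - r) ^ b) (Icc 0 1) := by
    have := (intervalIntegral.intervalIntegrable_rpow' (a := 1) (b := 0) hb).comp_sub_left 1
    simp only [sub_self, sub_zero] at this
    exact (intervalIntegrable_iff_integrableOn_Icc_of_le zero_le_one).1 this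
  have h2 : ContinuousOn (fun r : ℝ => r ^ 2 * (1 + r) ^ b) (Icc 0 1) := by
    refine ContinuousOn.mul (by fun_prop) (ContinuousOn.rpow_const (by fun_prop) ?_)
    intro r hr
    exact Or.inl (by linarith [hr.1])
  have h3 := (h1.mul_continuousOn h2 isCompact_Icc).mono_set Ioo_subset_Icc_self
  refine h3.congr_fun ?_ measurableSet_Ioo
  intro r hr
  simp only [finrank_euclideanSpace, Fintype.card_fin, smul_eq_mul]
  rw [show 1 - r ^ 2 = (1 - r) * (1 + r) by ring,
    Real.mul_rpow (by linarith [hr.2]) (by linarith [hr.1])]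
  ring

lemma sechDist_pos {x y : E3} (hx : ‖x‖ < 1) (hy : ‖y‖ < 1) : 0 < sechDist x y :=
  div_pos (mul_pos (one_sub_norm_sq_pos hx) (one_sub_norm_sq_pos hy)) (kerDen_pos hx y)

lemma sechDist_self {x : E3} (hx : ‖x‖ < 1) : sechDist x x = 1 := by
  have := (one_sub_norm_sq_pos hx).ne'
  rw [sechDist, kerDen_eq]
  simp [this]

lemma sechDist_le_one {x : E3} (hx : ‖x‖ < 1) (y : E3) : sechDist x y ≤ 1 := by
  rw [sechDist, div_le_one (kerDen_pos hx y), kerDen_eq]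
  nlinarith [sq_nonneg ‖x - y‖]

lemma sechDist_lt_one {x y : E3} (hx : ‖x‖ < 1) (hxy : y ≠ x) : sechDist x y < 1 := by
  have : 0 < ‖x - y‖ := norm_pos_iff.2 (sub_ne_zero.2 hxy.symm)
  rw [sechDist, div_lt_one (kerDen_pos hx y), kerDen_eq]
  nlinarith [pow_pos this 2]

lemma sechDist_nonneg {x y : E3} (hx : ‖x‖ < 1) (hy : ‖y‖ ≤ 1) : 0 ≤ sechDist x y := by
  have : 0 ≤ 1 - ‖y‖ ^ 2 := by nlinarith [norm_nonneg y]
  exact div_nonneg (mul_nonneg (one_sub_norm_sq_pos hx).le this) (kerDen_pos hx y).le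

/-- The weight `t ^ a dvol`, with `t` the hyperbolic secant of the distance from `x`. -/
def weight (x : E3) (a : ℝ) (y : E3) : ℝ := conf y ^ 3 * sechDist x y ^ a

lemma weight_eq {x y : E3} (hx : ‖x‖ < 1) (hy : ‖y‖ < 1) (a : ℝ) :
    weight x a y = 8 * (1 - ‖x‖ ^ 2) ^ a * ((1 - ‖y‖ ^ 2) ^ (a - 3) * (kerDen x y ^ a)⁻¹) := by
  have h1 := one_sub_norm_sq_pos hx
  have h2 := one_sub_norm_sq_pos hy
  rw [weight, conf, sechDist, Real.div_rpow (by positivity) (kerDen_pos hx y).le,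
    Real.mul_rpow h1.le h2.le, Real.rpow_sub h2, show ((3 : ℝ)) = ((3 : ℕ) : ℝ) by norm_num,
    Real.rpow_natCast]
  field_simp
  norm_num

lemma weight_nonneg {x y : E3} (hx : ‖x‖ < 1) (hy : ‖y‖ < 1) (a : ℝ) : 0 ≤ weight x a y :=
  mul_nonneg (pow_nonneg (conf_pos hy).le _) (Real.rpow_nonneg (sechDist_pos hx hy).le _)

lemma continuousOn_weight {x : E3} (hx : ‖x‖ < 1) (a : ℝ) :
    ContinuousOn (weight x a) (ball 0 1) := by
  refine ContinuousOn.mul ?_ ?_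
  · exact ContinuousOn.pow (fun y hy =>
      (contDiffAt_conf (by simpa using hy)).continuousAt.continuousWithinAt) 3
  · exact (contDiff_sechDist hx).continuous.continuousOn.rpow_const fun y hy =>
      Or.inl (sechDist_pos hx (by simpa using hy)).ne'

/-- A bound uniform in `y`, from `2 |y| ≤ 1 + |y|²`; it keeps the kernels bounded for fixed `x`. -/
lemma kerDen_ge {x : E3} (hx : ‖x‖ < 1) (y : E3) : (1 - ‖x‖) ^ 2 ≤ kerDen x y := by
  have h := real_inner_le_norm x y
  have h1 : 4 * (‖x‖ * ‖y‖) ≤ 2 * ‖x‖ * (1 + ‖y‖ ^ 2) := by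
    nlinarith [mul_nonneg (norm_nonneg x) (sq_nonneg (1 - ‖y‖))]
  have h2 : 0 ≤ (1 - ‖x‖) ^ 2 * ‖y‖ ^ 2 := by positivity
  rw [kerDen]; nlinarith

lemma integrableOn_weight {x : E3} (hx : ‖x‖ < 1) {a : ℝ} (ha : 2 < a) :
    IntegrableOn (weight x a) (ball 0 1) := by
  have hm : 0 < (1 - ‖x‖) ^ 2 := by have : 0 < 1 - ‖x‖ := by linarith
                                    positivity
  refine Integrable.mono' ((integrableOn_one_sub_norm_sq_rpow (b := a - 3) (by linarith)).const_mul
    (8 * (1 - ‖x‖ ^ 2) ^ a * (((1 - ‖x‖) ^ 2) ^ a)⁻¹))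
    ((continuousOn_weight hx a).aestronglyMeasurable measurableSet_ball) ?_
  refine ae_restrict_of_forall_mem measurableSet_ball fun y hy => ?_
  have hy1 : ‖y‖ < 1 := by simpa using hy
  have h1 := one_sub_norm_sq_pos hx
  have h2 := one_sub_norm_sq_pos hy1
  rw [Real.norm_of_nonneg (weight_nonneg hx hy1 a), weight_eq hx hy1]
  have : (kerDen x y ^ a)⁻¹ ≤ (((1 - ‖x‖) ^ 2) ^ a)⁻¹ := by
    gcongr
    exact kerDen_ge hx y
  calc _ = 8 * (1 - ‖x‖ ^ 2) ^ a * (kerDen x y ^ a)⁻¹ * (1 - ‖y‖ ^ 2) ^ (a - 3) := by ring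
    _ ≤ _ := by gcongr

lemma integrableOn_mul_weight {G : E3 → ℝ} (hG : ContinuousOn G (ball 0 1)) {M : ℝ}
    (hM : ∀ y ∈ ball (0 : E3) 1, |G y| ≤ M) {x : E3} (hx : ‖x‖ < 1) {a : ℝ} (ha : 2 < a) :
    IntegrableOn (fun y => G y * weight x a y) (ball 0 1) :=
  (integrableOn_weight hx ha).bdd_mul (c := M) (hG.aestronglyMeasurable measurableSet_ball)
    (ae_restrict_of_forall_mem measurableSet_ball fun y hy => hM y hy)

/-! ### Moments, peaking and the mean value property -/

/-- The recurrence between the moments of a bounded harmonic function. -/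
lemma moment_recurrence {G : E3 → ℝ} (hG : IsHypHarmonic G) {M : ℝ}
    (hM : ∀ y ∈ ball (0 : E3) 1, |G y| ≤ M) {x : E3} (hx : ‖x‖ < 1) {a : ℝ} (ha : 2 < a) :
    (a - 2) * ∫ y in ball (0 : E3) 1, G y * weight x a y
      = (a + 1) * ∫ y in ball (0 : E3) 1, G y * weight x (a + 2) y := by
  have hGc := hG.1.continuousOn
  set e : ℕ → ℝ := fun n => 1 / ((n : ℝ) + 1) with he
  have epos : ∀ n, 0 < e n := fun n => by positivity
  have elim : Tendsto e atTop (𝓝 0) := tendsto_one_div_add_atTop_nhds_zero_nat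
  -- The hyperbolic Laplacian of the truncated power. As `e n` tends to `0` it tends to `a (a - 2) t
  -- ^ a - a (a + 1) t ^ (a + 2)`.
  set K : ℕ → E3 → ℝ := fun n y =>
    (sechDist x y ^ 2 - sechDist x y ^ 4) * (a * (a - 1) * max (sechDist x y - e n) 0 ^ (a - 2))
      - (sechDist x y + 2 * sechDist x y ^ 3) * (a * max (sechDist x y - e n) 0 ^ (a - 1)) with hK
  have hzero : ∀ n, ∫ y in ball (0 : E3) 1, G y * (conf y ^ 3 * K n y) = 0 := by
    intro n
    have hψ := contDiff_max_sub_rpow ha (e n)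
    have := integral_mul_hypLaplacian_eq_zero hG (Φ := fun y => max (sechDist x y - e n) 0 ^ a)
      (hψ.comp (contDiff_sechDist hx)) ?_
    · refine Eq.trans ?_ this
      refine setIntegral_congr_fun measurableSet_ball fun y _ => ?_
      simp only [hK]
      rw [hypLaplacian_comp_sechDist hx hψ, deriv_deriv_max_sub_rpow ha,
        deriv_max_sub_rpow (by linarith)]
    · have : tsupport (fun y => max (sechDist x y - e n) 0 ^ a) ⊆ {y | e n ≤ sechDist x y} := by
        refine closure_minimal ?_ (isClosed_le continuous_const (contDiff_sechDist hx).continuous)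
        intro y hy
        by_contra h
        refine hy ?_
        simp only [mem_ofPred_eq, not_le] at h
        simp only
        rw [max_eq_right (by linarith), Real.zero_rpow (by linarith)]
      refine this.trans fun y hy => ?_
      have hy' : 0 < sechDist x y := (epos n).trans_le hy
      have h1 := one_sub_norm_sq_pos hx
      rw [sechDist, div_pos_iff_of_pos_right (kerDen_pos hx y), mul_pos_iff_of_pos_left h1] at hy'
      rw [mem_ball_zero_iff]
      nlinarith [norm_nonneg y]
  have hlim : Tendsto (fun n => ∫ y in ball (0 : E3) 1, G y * (conf y ^ 3 * K n y)) atTop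
      (𝓝 (∫ y in ball (0 : E3) 1, (a * (a - 2) * (G y * weight x a y)
        - a * (a + 1) * (G y * weight x (a + 2) y)))) := by
    -- The dominating constant comes from `t² - t⁴ ≤ t²`, `t + 2 t³ ≤ 3 t` and `max (t - e) 0 ≤ t`.
    refine tendsto_integral_of_dominated_convergence
      (fun y => (a * (a - 1) + 3 * a) * M * weight x a y) ?_
      ((integrableOn_weight hx ha).const_mul _) ?_ ?_
    · intro n
      refine ContinuousOn.aestronglyMeasurable ?_ measurableSet_ball
      refine hGc.mul (ContinuousOn.mul (ContinuousOn.pow (fun y hy =>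
        (contDiffAt_conf (by simpa using hy)).continuousAt.continuousWithinAt) 3) ?_)
      have hs := (contDiff_sechDist hx).continuous
      have hm : ∀ b : ℝ, 0 < b → Continuous fun y => max (sechDist x y - e n) 0 ^ b := fun b hb =>
        Continuous.rpow_const (by fun_prop) fun _ => Or.inr hb.le
      have h1 := hm (a - 2) (by linarith)
      have h2 := hm (a - 1) (by linarith)
      exact Continuous.continuousOn (by fun_prop)
    · intro n
      refine ae_restrict_of_forall_mem measurableSet_ball fun y hy => ?_
      have hy1 : ‖y‖ < 1 := by simpa using hy
      have t0 := sechDist_pos hx hy1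
      have t1 := sechDist_le_one hx y
      have hc : 0 ≤ conf y ^ 3 := pow_nonneg (conf_pos hy1).le _
      have hMn : 0 ≤ M := (abs_nonneg _).trans (hM y hy)
      have hmx : max (sechDist x y - e n) 0 ≤ sechDist x y :=
        max_le (by linarith [epos n]) t0.le
      have m0 : 0 ≤ max (sechDist x y - e n) 0 := le_max_right _ _
      have b2 : max (sechDist x y - e n) 0 ^ (a - 2) ≤ sechDist x y ^ (a - 2) :=
        Real.rpow_le_rpow m0 hmx (by linarith)
      have b1 : max (sechDist x y - e n) 0 ^ (a - 1) ≤ sechDist x y ^ (a - 1) :=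
        Real.rpow_le_rpow m0 hmx (by linarith)
      have p2 : sechDist x y ^ 2 * sechDist x y ^ (a - 2) = sechDist x y ^ a := by
        rw [← Real.rpow_natCast, ← Real.rpow_add t0]; norm_num
      have p1 : sechDist x y * sechDist x y ^ (a - 1) = sechDist x y ^ a := by
        conv_lhs => rw [← Real.rpow_one_add' t0.le (by linarith)]
        norm_num
      have n2 := Real.rpow_nonneg m0 (a - 2)
      have n1 := Real.rpow_nonneg m0 (a - 1)
      have ha1 : 0 ≤ a * (a - 1) := mul_nonneg (by linarith) (by linarith)
      have k2 : |(sechDist x y ^ 2 - sechDist x y ^ 4) *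
          (a * (a - 1) * max (sechDist x y - e n) 0 ^ (a - 2))| ≤ a * (a - 1) * sechDist x y ^ a := by
        have h4 : sechDist x y ^ 4 ≤ sechDist x y ^ 2 :=
          pow_le_pow_of_le_one t0.le t1 (by norm_num)
        rw [abs_of_nonneg (mul_nonneg (by linarith) (mul_nonneg ha1 n2)), ← p2]
        calc _ ≤ sechDist x y ^ 2 * (a * (a - 1) * sechDist x y ^ (a - 2)) := by
              gcongr
              nlinarith [pow_pos t0 4]
          _ = _ := by ring
      have k1 : |(sechDist x y + 2 * sechDist x y ^ 3) *
          (a * max (sechDist x y - e n) 0 ^ (a - 1))| ≤ 3 * a * sechDist x y ^ a := by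
        have h3 : sechDist x y ^ 3 ≤ sechDist x y := by
          simpa using pow_le_pow_of_le_one t0.le t1 (show 1 ≤ 3 by norm_num)
        rw [abs_of_nonneg (mul_nonneg (by positivity) (mul_nonneg (by linarith) n1)), ← p1]
        calc _ ≤ (3 * sechDist x y) * (a * sechDist x y ^ (a - 1)) := by
              gcongr
              linarith
          _ = _ := by ring
      rw [norm_mul, norm_mul, Real.norm_eq_abs, Real.norm_eq_abs, abs_of_nonneg hc, weight,
        Real.norm_eq_abs]
      have kk : |K n y| ≤ (a * (a - 1) + 3 * a) * sechDist x y ^ a := by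
        refine (abs_sub _ _).trans ?_
        linarith
      calc |G y| * (conf y ^ 3 * |K n y|)
          ≤ M * (conf y ^ 3 * ((a * (a - 1) + 3 * a) * sechDist x y ^ a)) := by
            gcongr
            exact hM y hy
        _ = _ := by ring
    · refine ae_restrict_of_forall_mem measurableSet_ball fun y hy => ?_
      have hy1 : ‖y‖ < 1 := by simpa using hy
      have t0 := sechDist_pos hx hy1
      have hmax : Tendsto (fun n => max (sechDist x y - e n) 0) atTop (𝓝 (sechDist x y)) := by
        have := (tendsto_const_nhds (x := sechDist x y)).sub elim |>.max
          (tendsto_const_nhds (x := (0 : ℝ)))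
        rwa [sub_zero, max_eq_left t0.le] at this
      have hr : ∀ b : ℝ, Tendsto (fun n => max (sechDist x y - e n) 0 ^ b) atTop
          (𝓝 (sechDist x y ^ b)) := fun b => hmax.rpow_const (Or.inl t0.ne')
      have := (((hr (a - 2)).const_mul (a * (a - 1))).const_mul
        (sechDist x y ^ 2 - sechDist x y ^ 4)).sub
        (((hr (a - 1)).const_mul a).const_mul (sechDist x y + 2 * sechDist x y ^ 3))
      have := (this.const_mul (conf y ^ 3)).const_mul (G y)
      refine this.congr' .rfl |>.trans_eq ?_
      congr 1
      have q1 : sechDist x y ^ (a - 1) = sechDist x y ^ (a - 2) * sechDist x y := by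
        rw [← Real.rpow_add_one t0.ne']; ring_nf
      have q0 : sechDist x y ^ a = sechDist x y ^ (a - 2) * sechDist x y ^ 2 := by
        rw [← Real.rpow_natCast, ← Real.rpow_add t0]; norm_num
      have q2 : sechDist x y ^ (a + 2) = sechDist x y ^ (a - 2) * sechDist x y ^ 4 := by
        rw [← Real.rpow_natCast, ← Real.rpow_add t0]; ring_nf
      rw [weight, weight, q0, q1, q2]
      ring
  have h0 := tendsto_nhds_unique hlim (by simp only [hzero]; exact tendsto_const_nhds)
  rw [integral_sub ((integrableOn_mul_weight hGc hM hx ha).const_mul _)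
    ((integrableOn_mul_weight hGc hM hx (by linarith)).const_mul _), integral_const_mul,
    integral_const_mul] at h0
  have : a ≠ 0 := by linarith
  refine mul_left_cancel₀ this ?_
  linarith

/-- The constant `1` serves as the reference function: comparing its moments with those of `G`
eliminates all normalizing factors. -/
lemma isHypHarmonic_const (c : ℝ) : IsHypHarmonic fun _ => c := by
  refine ⟨contDiffOn_const, fun x _ => ?_⟩
  have : Laplacian.laplacian (fun _ : E3 => c) = 0 := laplacian_const
  simp [hypLaplacian, this]

/-- The peak argument: high powers of the hyperbolic secant form an approximate identity. -/
lemma tendsto_peak {G : E3 → ℝ} (hG : ContinuousOn G (ball 0 1)) {M : ℝ}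
    (hM : ∀ y ∈ ball (0 : E3) 1, |G y| ≤ M) {x : E3} (hx : ‖x‖ < 1) {a : ℝ} (ha : 2 < a) :
    Tendsto (fun n : ℕ => (∫ y in closedBall (0 : E3) 1, (sechDist x y ^ 2) ^ n)⁻¹ *
      ∫ y in ball (0 : E3) 1, G y * weight x (a + 2 * n) y) atTop (𝓝 (G x * weight x a x)) := by
  have hxb : x ∈ ball (0 : E3) 1 := by simpa using hx
  -- The peak theorem needs a compact set. On the sphere `conf` is `0` by the convention for
  -- division by zero, so passing to the closed ball changes no integral.
  have hout : ∀ y ∈ closedBall (0 : E3) 1 \ ball 0 1, conf y = 0 := by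
    intro y hy
    have : ‖y‖ = 1 := le_antisymm (by simpa using hy.1) (by simpa using hy.2)
    simp [conf, this]
  have key := tendsto_setIntegral_pow_smul_of_unique_maximum_of_isCompact_of_integrableOn
    (μ := (volume : Measure E3)) (isCompact_closedBall (0 : E3) 1) (x₀ := x)
    (c := fun y => sechDist x y ^ 2) (g := fun y => G y * weight x a y)
    ((contDiff_sechDist hx).continuous.pow 2).continuousOn ?_ ?_ ?_ ?_ ?_ ?_
  · refine key.congr fun n => ?_
    rw [smul_eq_mul]
    congr 1
    rw [setIntegral_eq_of_subset_of_forall_sdiff_eq_zero measurableSet_closedBall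
      ball_subset_closedBall (fun y hy => by simp [weight, hout y hy])]
    refine setIntegral_congr_fun measurableSet_ball fun y hy => ?_
    have t0 := sechDist_pos hx (show ‖y‖ < 1 by simpa using hy)
    simp only [weight, smul_eq_mul]
    rw [Real.rpow_add t0, ← pow_mul, ← Real.rpow_natCast]
    push_cast
    ring
  · intro y hy hyx
    have t0 := sechDist_nonneg hx (show ‖y‖ ≤ 1 by simpa using hy)
    have t1 := sechDist_lt_one hx hyx
    simp only [sechDist_self hx]
    nlinarith
  · exact fun y _ => sq_nonneg _
  · simp [sechDist_self hx]
  · exact subset_closure (interior_mono ball_subset_closedBall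
      (by rwa [isOpen_ball.interior_eq]))
  · exact (integrableOn_mul_weight hG hM hx ha).of_forall_sdiff_eq_zero measurableSet_closedBall
      fun y hy => by simp [weight, hout y hy]
  · exact ((hG.continuousAt (isOpen_ball.mem_nhds hxb)).mul
      ((continuousOn_weight hx a).continuousAt (isOpen_ball.mem_nhds hxb))).continuousWithinAt

/-- What matters is that the product does not involve `G`. -/
lemma moment_iterate {G : E3 → ℝ} (hG : IsHypHarmonic G) {M : ℝ}
    (hM : ∀ y ∈ ball (0 : E3) 1, |G y| ≤ M) {x : E3} (hx : ‖x‖ < 1) {a : ℝ} (ha : 2 < a) (n : ℕ) :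
    ∫ y in ball (0 : E3) 1, G y * weight x (a + 2 * n) y
      = (∏ k ∈ Finset.range n, (a + 2 * k - 2) / (a + 2 * k + 1)) *
        ∫ y in ball (0 : E3) 1, G y * weight x a y := by
  induction n with
  | zero => simp
  | succ n ih =>
    have hn : (0 : ℝ) ≤ n := n.cast_nonneg
    have h := moment_recurrence hG hM hx (a := a + 2 * n) (by linarith)
    rw [Finset.prod_range_succ, mul_right_comm, ← ih]
    have h1 : a + 2 * n + 1 ≠ 0 := by linarith
    rw [show a + 2 * ((n + 1 : ℕ) : ℝ) = a + 2 * n + 2 by push_cast; ring]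
    field_simp
    linarith

/-- The mean value property of bounded harmonic functions. -/
lemma mean_value {G : E3 → ℝ} (hG : IsHypHarmonic G) {M : ℝ}
    (hM : ∀ y ∈ ball (0 : E3) 1, |G y| ≤ M) {x : E3} (hx : ‖x‖ < 1) {a : ℝ} (ha : 2 < a) :
    ∫ y in ball (0 : E3) 1, G y * weight x a y = G x * ∫ y in ball (0 : E3) 1, weight x a y := by
  have h1 := tendsto_peak hG.1.continuousOn hM hx ha
  have h2 := tendsto_peak (isHypHarmonic_const 1).1.continuousOn (M := 1) (by simp) hx ha
  simp only [moment_iterate hG hM hx ha] at h1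
  have h1' := moment_iterate (isHypHarmonic_const 1) (M := 1) (by simp) hx ha
  simp only [one_mul] at h1' h2
  simp only [h1'] at h2
  have h3 := h1.mul_const (∫ y in ball (0 : E3) 1, weight x a y)
  have h4 := h2.mul_const (∫ y in ball (0 : E3) 1, G y * weight x a y)
  -- Both sequences are the same product of normalization, recurrence factor, moment of `G` and
  -- moment of `1`, so their limits agree.
  have h5 := tendsto_nhds_unique h3 (h4.congr fun n => by ring)
  have hw : weight x a x ≠ 0 := by
    simp [weight, sechDist_self hx, (conf_pos hx).ne']
  refine mul_left_cancel₀ hw ?_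
  linarith

/-! ### Invariance of the total weight -/

open EuclideanGeometry in
/-- The total weight does not depend on the center: the inversion that exchanges `x` and `0`
preserves the ball and the hyperbolic volume. -/
lemma integral_weight_eq {x : E3} (hx : ‖x‖ < 1) (a : ℝ) :
    ∫ y in ball (0 : E3) 1, weight x a y = ∫ y in ball (0 : E3) 1, weight 0 a y := by
  rcases eq_or_ne x 0 with rfl | hx0
  · rfl
  have hxn : 0 < ‖x‖ := norm_pos_iff.2 hx0
  set X := ‖x‖ ^ 2 with hX
  have hXpos : 0 < X := by positivity
  have hX1 : X < 1 := by nlinarith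
  -- The sphere of center `x / |x|²` and squared radius `|x|⁻² - 1` is orthogonal to the unit
  -- sphere, since `|c|² = R² + 1`.
  set c : E3 := X⁻¹ • x with hc
  set R : ℝ := Real.sqrt (X⁻¹ - 1) with hR
  have hRpos : 0 < X⁻¹ - 1 := by rw [sub_pos]; exact (one_lt_inv₀ hXpos).2 hX1
  have hR2 : R ^ 2 = X⁻¹ - 1 := Real.sq_sqrt hRpos.le
  have hR0 : R ≠ 0 := (Real.sqrt_pos.2 hRpos).ne'
  have hcn : ‖c‖ ^ 2 = X⁻¹ := by
    rw [hc, norm_smul, mul_pow, ← hX, Real.norm_eq_abs, sq_abs]; field_simp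
  have hcx : ∀ y : E3, inner ℝ c y = X⁻¹ * inner ℝ x y := fun y => by
    rw [hc, real_inner_smul_left]
  have hne : ∀ y ∈ ball (0 : E3) 1, y ≠ c := by
    rintro y hy rfl
    have : ‖c‖ < 1 := by simpa using hy
    have h1 : 1 < X⁻¹ := by linarith
    nlinarith [norm_nonneg c]
  have hD : ∀ y : E3, ‖y - c‖ ^ 2 = ‖y‖ ^ 2 - 2 * X⁻¹ * inner ℝ x y + X⁻¹ := fun y => by
    rw [norm_sub_sq_real, hcn, real_inner_comm, hcx]; ring
  have hDpos : ∀ y ∈ ball (0 : E3) 1, 0 < ‖y - c‖ ^ 2 := fun y hy =>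
    pow_pos (norm_pos_iff.2 (sub_ne_zero.2 (hne y hy))) 2
  have hinv : ∀ y, inversion c R y = (R ^ 2 / ‖y - c‖ ^ 2) • (y - c) + c := fun y => by
    simp [inversion, dist_eq_norm, div_pow]
  have hnorm : ∀ y ∈ ball (0 : E3) 1,
      1 - ‖inversion c R y‖ ^ 2 = (1 - ‖y‖ ^ 2) * (R ^ 2 / ‖y - c‖ ^ 2) := by
    intro y hy
    have hp : ‖y - c‖ ≠ 0 := norm_ne_zero_iff.2 (sub_ne_zero.2 (hne y hy))
    rw [hinv, norm_add_sq_real, norm_smul, mul_pow, real_inner_smul_left, inner_sub_left,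
      real_inner_self_eq_norm_sq, hcn, real_inner_comm, hcx, Real.norm_eq_abs, sq_abs]
    have e := hD y
    have e' : X⁻¹ * inner ℝ x y = (‖y‖ ^ 2 + X⁻¹ - ‖y - c‖ ^ 2) / 2 := by rw [e]; ring
    rw [e', hR2]
    field_simp
    ring
  have hker : ∀ y ∈ ball (0 : E3) 1,
      sechDist x (inversion c R y) = sechDist 0 y := by
    intro y hy
    have hy1 : ‖y‖ < 1 := by simpa using hy
    have hp : ‖y - c‖ ≠ 0 := norm_ne_zero_iff.2 (sub_ne_zero.2 (hne y hy))
    have e : kerDen x (inversion c R y) = (1 - X) * (1 + ‖y‖ ^ 2) * (R ^ 2 / ‖y - c‖ ^ 2) := by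
      have hn := hnorm y hy
      have hi : inner ℝ x (inversion c R y) = (R ^ 2 / ‖y - c‖ ^ 2) * (inner ℝ x y - 1) + 1 := by
        rw [hinv, inner_add_right, real_inner_smul_right, inner_sub_right, real_inner_comm c,
          hcx, real_inner_self_eq_norm_sq, ← hX, inv_mul_cancel₀ hXpos.ne']
      have e' : inner ℝ x y = X * (‖y‖ ^ 2 + X⁻¹ - ‖y - c‖ ^ 2) / 2 := by
        rw [hD y]; field_simp; ring
      rw [kerDen, hi, e', show ‖inversion c R y‖ ^ 2
        = 1 - (1 - ‖y‖ ^ 2) * (R ^ 2 / ‖y - c‖ ^ 2) by linarith, ← hX, hR2]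
      field_simp
      ring
    have h1 : 1 - X ≠ 0 := by linarith
    have h2 : (1 : ℝ) + ‖y‖ ^ 2 ≠ 0 := by positivity
    rw [sechDist, e, hnorm y hy, ← hX, sechDist, kerDen]
    simp only [norm_zero, inner_zero_left]
    have h3 : R ^ 2 / ‖y - c‖ ^ 2 ≠ 0 := div_ne_zero (pow_ne_zero 2 hR0) (pow_ne_zero 2 hp)
    rw [show ((1 : ℝ) + 0 ^ 2) * (1 + ‖y‖ ^ 2) - 4 * 0 = 1 + ‖y‖ ^ 2 by ring]
    field_simp
    ring
  have himage : inversion c R '' ball 0 1 = ball (0 : E3) 1 := by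
    have hmaps : ∀ y ∈ ball (0 : E3) 1, inversion c R y ∈ ball (0 : E3) 1 := by
      intro y hy
      have hn := hnorm y hy
      have : 0 < (1 - ‖y‖ ^ 2) * (R ^ 2 / ‖y - c‖ ^ 2) :=
        mul_pos (one_sub_norm_sq_pos (by simpa using hy))
          (div_pos (by rw [hR2]; exact hRpos) (hDpos y hy))
      rw [mem_ball_zero_iff]
      nlinarith [norm_nonneg (inversion c R y)]
    refine subset_antisymm (image_subset_iff.2 hmaps) fun y hy => ?_
    exact ⟨inversion c R y, hmaps y hy, inversion_inversion c hR0 y⟩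
  have hchange := integral_image_eq_integral_abs_det_fderiv_smul (volume : Measure E3)
    (s := ball (0 : E3) 1) measurableSet_ball (f := inversion c R)
    (f' := fun y => (R / dist y c) ^ 2 • ((ℝ ∙ (y - c))ᗮ.reflection : E3 →L[ℝ] E3))
    (fun y hy => (hasFDerivAt_inversion (hne y hy)).hasFDerivWithinAt)
    (inversion_injective c hR0).injOn (weight x a)
  rw [himage] at hchange
  rw [hchange]
  refine setIntegral_congr_fun measurableSet_ball fun y hy => ?_
  have hp : ‖y - c‖ ≠ 0 := norm_ne_zero_iff.2 (sub_ne_zero.2 (hne y hy))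
  -- The derivative is a conformal factor times a reflection, so the Jacobian is the cube of that
  -- factor. It cancels the change of `conf ^ 3` given by `hnorm`.
  have hdet : |((R / dist y c) ^ 2 • ((ℝ ∙ (y - c))ᗮ.reflection : E3 →L[ℝ] E3)).det|
      = (R ^ 2 / ‖y - c‖ ^ 2) ^ 3 := by
    have h1 : LinearMap.det ((ℝ ∙ (y - c))ᗮ.reflection.toLinearMap) = _ :=
      Submodule.det_reflection _
    rw [ContinuousLinearMap.det, ContinuousLinearMap.toLinearMap_smul, LinearMap.det_smul]
    erw [h1]
    rw [abs_mul, abs_pow _ (Module.finrank ℝ E3), abs_pow (-1 : ℝ), abs_neg, abs_one, one_pow, mul_one, finrank_euclideanSpace,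
      Fintype.card_fin, abs_of_nonneg (by positivity), dist_eq_norm, div_pow]
  simp only [smul_eq_mul]
  rw [hdet, weight, weight, hker y hy, conf, conf, hnorm y hy]
  have : R ^ 2 ≠ 0 := pow_ne_zero 2 hR0
  have := (one_sub_norm_sq_pos (show ‖y‖ < 1 by simpa using hy)).ne'
  field_simp

/-! ### Weak-* limits of densities -/

/-- Weak-* compactness: densities of bounded mass on a compact space have a positive functional as
a limit point. -/
lemma exists_functional_of_bounded_mass {K : Type*} [TopologicalSpace K] [CompactSpace K]
    [MeasurableSpace K] [BorelSpace K] (μ : Measure K) (w : ℕ → K → ℝ) (hw : ∀ n y, 0 ≤ w n y)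
    (hi : ∀ n, Integrable (w n) μ) {M : ℝ} (hM : ∀ n, ∫ y, w n y ∂μ ≤ M) :
    ∃ ℓ : C(K, ℝ) →L[ℝ] ℝ, (∀ φ : C(K, ℝ), (∀ y, 0 ≤ φ y) → 0 ≤ ℓ φ) ∧
      ∀ (φ : ℕ → C(K, ℝ)) (φ' : C(K, ℝ)) (r : ℝ), Tendsto φ atTop (𝓝 φ') →
        Tendsto (fun n => ∫ y, φ n y * w n y ∂μ) atTop (𝓝 r) → ℓ φ' = r := by
  have hφi : ∀ n (φ : C(K, ℝ)), Integrable (fun y => φ y * w n y) μ := fun n φ =>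
    (hi n).bdd_mul (c := ‖φ‖) φ.continuous.measurable.aestronglyMeasurable
      (Eventually.of_forall fun y => φ.norm_coe_le_norm y)
  have hbound : ∀ n (φ : C(K, ℝ)), ‖∫ y, φ y * w n y ∂μ‖ ≤ M * ‖φ‖ := by
    intro n φ
    calc ‖∫ y, φ y * w n y ∂μ‖ ≤ ∫ y, ‖φ‖ * w n y ∂μ := by
          refine norm_integral_le_of_norm_le ((hi n).const_mul _) (Eventually.of_forall fun y => ?_)
          rw [norm_mul, Real.norm_of_nonneg (hw n y)]
          exact mul_le_mul_of_nonneg_right (φ.norm_coe_le_norm y) (hw n y)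
      _ = ‖φ‖ * ∫ y, w n y ∂μ := integral_const_mul _ _
      _ ≤ M * ‖φ‖ := by
          rw [mul_comm]
          exact mul_le_mul_of_nonneg_right (hM n) (norm_nonneg φ)
  have hM0 : 0 ≤ M := (integral_nonneg (hw 0)).trans (hM 0)
  let L : ℕ → C(K, ℝ) →L[ℝ] ℝ := fun n => LinearMap.mkContinuous
    { toFun := fun φ => ∫ y, φ y * w n y ∂μ
      map_add' := fun φ φ' => by
        rw [← integral_add (hφi n φ) (hφi n φ')]
        simp [add_mul]
      map_smul' := fun c φ => by
        rw [RingHom.id_apply, smul_eq_mul, ← integral_const_mul]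
        simp [mul_assoc] } M (hbound n)
  have hL : ∀ n φ, L n φ = ∫ y, φ y * w n y ∂μ := fun n φ => rfl
  have hLn : ∀ n, ‖L n‖ ≤ M := fun n => LinearMap.mkContinuous_norm_le _ hM0 _
  -- Banach–Alaoglu along a nonprincipal ultrafilter, which avoids extracting a subsequence.
  obtain ⟨ℓ, -, hℓ⟩ := (WeakDual.isCompact_closedBall (𝕜 := ℝ) (0 : StrongDual ℝ C(K, ℝ)) M
    ).ultrafilter_le_nhds ((hyperfilter ℕ).map fun n => StrongDual.toWeakDual (L n)) (by
      rw [le_principal_iff]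
      refine Filter.mem_map.2 (Eventually.of_forall fun n => ?_)
      simpa using hLn n)
  have hconv : ∀ φ : C(K, ℝ), Tendsto (fun n => L n φ) (hyperfilter ℕ) (𝓝 (ℓ φ)) := fun φ =>
    ((WeakDual.eval_continuous φ).tendsto ℓ).comp hℓ
  refine ⟨WeakDual.toStrongDual ℓ, ?_, ?_⟩
  · intro φ hφ
    refine ge_of_tendsto' (hconv φ) fun n => ?_
    rw [hL]
    exact integral_nonneg fun y => mul_nonneg (hφ y) (hw n y)
  · intro φ φ' r hφ hr
    -- The test functions may vary with `n`, because the `L n` are uniformly bounded.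
    have h1 : Tendsto (fun n => L n (φ n) - L n φ') atTop (𝓝 0) := by
      refine squeeze_zero_norm (a := fun n => M * ‖φ n - φ'‖) (fun n => ?_) ?_
      · rw [← map_sub]
        exact ((L n).le_opNorm _).trans (mul_le_mul_of_nonneg_right (hLn n) (norm_nonneg _))
      · simpa using (tendsto_iff_norm_sub_tendsto_zero.1 hφ).const_mul M
    have h2 := ((hr.sub h1).mono_left Nat.hyperfilter_le_atTop)
    rw [sub_zero] at h2
    refine tendsto_nhds_unique (hconv φ') (h2.congr fun n => ?_)
    rw [← hL]
    ring

/-! ### Concentration on the sphere as the exponent tends to 2 -/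

/-- The factor of `weight x a` that does not depend on `x`. -/
def dens (a : ℝ) (y : E3) : ℝ := conf y ^ 3 * (1 - ‖y‖ ^ 2) ^ a

lemma weight_eq_dens {x y : E3} (hx : ‖x‖ < 1) (hy : ‖y‖ < 1) (a : ℝ) :
    weight x a y = (1 - ‖x‖ ^ 2) ^ a * (dens a y * (kerDen x y ^ a)⁻¹) := by
  have h1 := one_sub_norm_sq_pos hx
  have h2 := one_sub_norm_sq_pos hy
  rw [weight, dens, sechDist, Real.div_rpow (by positivity) (kerDen_pos hx y).le,
    Real.mul_rpow h1.le h2.le]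
  ring

lemma dens_eq {y : E3} (hy : ‖y‖ < 1) (a : ℝ) : dens a y = 8 * (1 - ‖y‖ ^ 2) ^ (a - 3) := by
  have h2 := one_sub_norm_sq_pos hy
  rw [dens, conf, Real.rpow_sub h2, show ((3 : ℝ)) = ((3 : ℕ) : ℝ) by norm_num,
    Real.rpow_natCast]
  field_simp
  norm_num

lemma dens_nonneg {y : E3} (hy : ‖y‖ ≤ 1) (a : ℝ) : 0 ≤ dens a y := by
  have : 0 ≤ 1 - ‖y‖ ^ 2 := by nlinarith [norm_nonneg y]
  exact mul_nonneg (pow_nonneg (div_nonneg two_pos.le this) _) (Real.rpow_nonneg this _)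

lemma dens_eq_zero {y : E3} (hy : ‖y‖ = 1) (a : ℝ) : dens a y = 0 := by simp [dens, conf, hy]

lemma integrableOn_dens {a : ℝ} (ha : 2 < a) : IntegrableOn (dens a) (ball 0 1) := by
  refine IntegrableOn.congr_fun ((integrableOn_one_sub_norm_sq_rpow (b := a - 3)
    (by linarith)).const_mul 8) (fun y hy => ?_) measurableSet_ball
  rw [dens_eq (by simpa using hy)]

/-- The total weight. -/
def totalWeight (a : ℝ) : ℝ := ∫ y in ball (0 : E3) 1, weight 0 a y

/-- If it vanished, so would all moments with exponent `a + 2 n`, whereas after normalization they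
converge to `conf 0 ^ 3 > 0`. -/
lemma totalWeight_pos {a : ℝ} (ha : 2 < a) : 0 < totalWeight a := by
  have h0 : ‖(0 : E3)‖ < 1 := by simp
  refine lt_of_le_of_ne (setIntegral_nonneg measurableSet_ball fun y hy =>
    weight_nonneg h0 (by simpa using hy) a) fun h => ?_
  have h2 := tendsto_peak (isHypHarmonic_const 1).1.continuousOn (M := 1) (by simp) h0 ha
  have h1' := moment_iterate (isHypHarmonic_const 1) (M := 1) (by simp) h0 ha
  simp only [one_mul] at h1' h2
  have h3 : ∫ y in ball (0 : E3) 1, weight 0 a y = 0 := h.symm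
  simp only [h1', h3, mul_zero] at h2
  have h4 := tendsto_nhds_unique tendsto_const_nhds h2
  have h5 := pow_pos (conf_pos h0) 3
  simp only [weight, sechDist_self h0, Real.one_rpow, mul_one] at h4
  exact h5.ne h4

/-- At the center `kerDen 0 y = 1 + |y|² ≤ 2`. Hence the normalized densities have bounded mass for
`a ≤ 3`. -/
lemma integral_dens_le {a : ℝ} (ha : 2 < a) :
    ∫ y in ball (0 : E3) 1, dens a y ≤ 2 ^ a * totalWeight a := by
  have h0 : ‖(0 : E3)‖ < 1 := by simp
  rw [totalWeight, ← integral_const_mul]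
  refine setIntegral_mono_on (integrableOn_dens ha) ((integrableOn_weight h0 ha).const_mul _)
    measurableSet_ball fun y hy => ?_
  have hy1 : ‖y‖ < 1 := by simpa using hy
  have hk : kerDen 0 y = 1 + ‖y‖ ^ 2 := by simp [kerDen]
  have hk0 : 0 < 1 + ‖y‖ ^ 2 := by positivity
  rw [weight_eq_dens h0 hy1, hk]
  have h1 : (1 + ‖y‖ ^ 2) ^ a ≤ 2 ^ a :=
    Real.rpow_le_rpow hk0.le (by nlinarith [norm_nonneg y]) (by linarith)
  have h2 : 0 < (1 + ‖y‖ ^ 2) ^ a := Real.rpow_pos_of_pos hk0 a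
  have h3 : 1 ≤ 2 ^ a * ((1 + ‖y‖ ^ 2) ^ a)⁻¹ := by
    rw [← div_eq_mul_inv, one_le_div h2]; exact h1
  simp only [norm_zero]
  norm_num
  nlinarith [mul_le_mul_of_nonneg_left h3 (dens_nonneg hy1.le a)]

/-- The recurrence for the constant `1` shows that the total weight blows up at least like `1 / (a -
2)`, which drives the mass to the sphere. -/
lemma inv_totalWeight_le {a : ℝ} (ha : 2 < a) (ha3 : a ≤ 3) :
    (totalWeight a)⁻¹ ≤ (a - 2) / (3 * totalWeight 5) := by
  have h0 : ‖(0 : E3)‖ < 1 := by simp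
  have h := moment_recurrence (isHypHarmonic_const 1) (M := 1) (by simp) h0 ha
  simp only [one_mul] at h
  have h5 : totalWeight 5 ≤ totalWeight (a + 2) := by
    refine setIntegral_mono_on (integrableOn_weight h0 (by norm_num))
      (integrableOn_weight h0 (by linarith)) measurableSet_ball fun y hy => ?_
    have hy1 : ‖y‖ < 1 := by simpa using hy
    exact mul_le_mul_of_nonneg_left (Real.rpow_le_rpow_of_exponent_ge (sechDist_pos h0 hy1)
      (sechDist_le_one h0 y) (by linarith)) (pow_nonneg (conf_pos hy1).le _)
  have p5 := totalWeight_pos (a := 5) (by norm_num)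
  have pa := totalWeight_pos ha
  change (a - 2) * totalWeight a = (a + 1) * totalWeight (a + 2) at h
  rw [inv_eq_one_div, div_le_div_iff₀ pa (by positivity)]
  nlinarith

/-- The mean value property with the dependence on `x` isolated in `(1 - |x|²) ^ a` and the kernel.
As `a` tends to `2` it becomes the Poisson formula. -/
lemma eq_integral_dens {G : E3 → ℝ} (hG : IsHypHarmonic G) {M : ℝ}
    (hM : ∀ y ∈ ball (0 : E3) 1, |G y| ≤ M) {x : E3} (hx : ‖x‖ < 1) {a : ℝ} (ha : 2 < a) :
    G x = (1 - ‖x‖ ^ 2) ^ a *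
      ∫ y in ball (0 : E3) 1, (kerDen x y ^ a)⁻¹ * (G y * dens a y / totalWeight a) := by
  have h := mean_value hG hM hx ha
  rw [integral_weight_eq hx] at h
  have hp := totalWeight_pos ha
  rw [← totalWeight, eq_comm, ← eq_div_iff hp.ne'] at h
  rw [h, ← integral_div, ← integral_const_mul]
  refine setIntegral_congr_fun measurableSet_ball fun y hy => ?_
  have hy1 : ‖y‖ < 1 := by simpa using hy
  rw [weight_eq_dens hx hy1]
  ring

/-- A function that vanishes on a portion of the sphere has no mass there in the limit. -/
lemma tendsto_mass_near {G : E3 → ℝ}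
    (h0 : ∀ y ∈ ball (0 : E3) 1, 0 ≤ G y) (h1 : ∀ y ∈ ball (0 : E3) 1, G y ≤ 1) {q : E3} {δ : ℝ}
    (hcont : ContinuousOn G (closedBall 0 1 ∩ closedBall q δ))
    (hz : ∀ y ∈ closedBall q δ, ‖y‖ = 1 → G y = 0) {x : E3} (hx : ‖x‖ < 1)
    {a : ℕ → ℝ} (ha2 : ∀ n, 2 < a n) (ha3 : ∀ n, a n ≤ 3) (ha : Tendsto a atTop (𝓝 2)) :
    Tendsto (fun n => ∫ y in ball (0 : E3) 1 ∩ ball q δ,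
      (kerDen x y ^ a n)⁻¹ * (G y * dens (a n) y / totalWeight (a n))) atTop (𝓝 0) := by
  set m := (1 - ‖x‖) ^ 2 with hm
  have hx1 : 0 < 1 - ‖x‖ := by linarith
  have hmpos : 0 < m := by positivity
  have hm1 : m ≤ 1 := by nlinarith [norm_nonneg x]
  have hms : MeasurableSet (ball (0 : E3) 1 ∩ ball q δ) := measurableSet_ball.inter measurableSet_ball
  -- The part of the patch where `G ≥ η` is compact and misses the sphere. There `1 - |y|²` is
  -- bounded below, so a multiple of it dominates `G ≤ 1`.
  have hlin : ∀ η > 0, ∃ C, 0 ≤ C ∧ ∀ y ∈ ball (0 : E3) 1 ∩ ball q δ,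
      G y ≤ η + C * (1 - ‖y‖ ^ 2) := by
    intro η hη
    have hcpt : IsCompact (closedBall (0 : E3) 1 ∩ closedBall q δ) :=
      (isCompact_closedBall 0 1).inter_right isClosed_closedBall
    have hT : IsCompact ((closedBall (0 : E3) 1 ∩ closedBall q δ) ∩ G ⁻¹' Ici η) :=
      hcpt.of_isClosed_subset (hcont.preimage_isClosed_of_isClosed hcpt.isClosed isClosed_Ici)
        inter_subset_left
    rcases ((closedBall (0 : E3) 1 ∩ closedBall q δ) ∩ G ⁻¹' Ici η).eq_empty_or_nonempty
      with hE | hE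
    · refine ⟨0, le_rfl, fun y hy => ?_⟩
      by_contra hc
      have : y ∈ ((closedBall (0 : E3) 1 ∩ closedBall q δ) ∩ G ⁻¹' Ici η) :=
        ⟨⟨ball_subset_closedBall hy.1, ball_subset_closedBall hy.2⟩, by
          simp only [zero_mul, add_zero, not_le] at hc; exact hc.le⟩
      rw [hE] at this
      exact this
    · obtain ⟨z, hzT, hzmax⟩ := hT.exists_isMaxOn hE (f := fun y : E3 => ‖y‖)
        continuous_norm.continuousOn
      have hz1 : ‖z‖ < 1 := by
        refine lt_of_le_of_ne (by simpa using hzT.1.1) fun h => ?_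
        have := hz z hzT.1.2 h
        have h' : η ≤ G z := hzT.2
        linarith
      have hzp := one_sub_norm_sq_pos hz1
      refine ⟨(1 - ‖z‖ ^ 2)⁻¹, by positivity, fun y hy => ?_⟩
      have hyp := one_sub_norm_sq_pos (show ‖y‖ < 1 by simpa using hy.1)
      by_cases hc : η ≤ G y
      · have hyz : ‖y‖ ≤ ‖z‖ :=
          hzmax ⟨⟨ball_subset_closedBall hy.1, ball_subset_closedBall hy.2⟩, hc⟩
        have : 1 ≤ (1 - ‖z‖ ^ 2)⁻¹ * (1 - ‖y‖ ^ 2) := by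
          rw [inv_mul_eq_div, one_le_div hzp]
          nlinarith [norm_nonneg y]
        linarith [h1 y hy.1]
      · have : 0 ≤ (1 - ‖z‖ ^ 2)⁻¹ * (1 - ‖y‖ ^ 2) := by positivity
        linarith
  have hnn : ∀ n, 0 ≤ ∫ y in ball (0 : E3) 1 ∩ ball q δ,
      (kerDen x y ^ a n)⁻¹ * (G y * dens (a n) y / totalWeight (a n)) := fun n =>
    setIntegral_nonneg hms fun y hy => mul_nonneg
      (inv_nonneg.2 (Real.rpow_nonneg (kerDen_pos hx y).le _))
      (div_nonneg (mul_nonneg (h0 y hy.1) (dens_nonneg (by simpa using (mem_ball_zero_iff.1 hy.1).le) _))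
        (totalWeight_pos (ha2 n)).le)
  set V : ℝ := volume.real (ball (0 : E3) 1) with hV
  have hupper : ∀ η > 0, ∀ C, 0 ≤ C → (∀ y ∈ ball (0 : E3) 1 ∩ ball q δ,
      G y ≤ η + C * (1 - ‖y‖ ^ 2)) → ∀ n, ∫ y in ball (0 : E3) 1 ∩ ball q δ,
      (kerDen x y ^ a n)⁻¹ * (G y * dens (a n) y / totalWeight (a n))
        ≤ (m ^ (3 : ℝ))⁻¹ * (8 * η + 8 * C * V * ((a n - 2) / (3 * totalWeight 5))) := by
    intro η hη C hC hGC n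
    have pw := totalWeight_pos (ha2 n)
    have pw5 := totalWeight_pos (a := 5) (by norm_num)
    have hdi := integrableOn_dens (ha2 n)
    have hci : IntegrableOn (fun _ : E3 => (8 * C : ℝ)) (ball (0 : E3) 1) :=
      integrableOn_const measure_ball_lt_top.ne
    have hfi : IntegrableOn (fun y => (m ^ (3 : ℝ))⁻¹ * ((η * dens (a n) y + 8 * C)
        / totalWeight (a n))) (ball (0 : E3) 1) :=
      (((hdi.const_mul η).add hci).div_const _).const_mul _
    have hpt : ∀ y ∈ ball (0 : E3) 1 ∩ ball q δ,
        (kerDen x y ^ a n)⁻¹ * (G y * dens (a n) y / totalWeight (a n))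
        ≤ (m ^ (3 : ℝ))⁻¹ * ((η * dens (a n) y + 8 * C) / totalWeight (a n)) := by
      intro y hy
      have hy1 : ‖y‖ < 1 := by simpa using hy.1
      have hyp := one_sub_norm_sq_pos hy1
      have hd := dens_nonneg hy1.le (a n)
      have hk : (kerDen x y ^ a n)⁻¹ ≤ (m ^ (3 : ℝ))⁻¹ := by
        gcongr
        calc m ^ (3 : ℝ) ≤ m ^ a n := Real.rpow_le_rpow_of_exponent_ge hmpos hm1 (ha3 n)
          _ ≤ _ := Real.rpow_le_rpow hmpos.le (kerDen_ge hx y) (by linarith [ha2 n])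
      have hg : G y * dens (a n) y ≤ η * dens (a n) y + 8 * C := by
        -- The extra factor makes the density bounded uniformly in `n`, so that division by the
        -- total weight sends this term to zero.
        have e : dens (a n) y * (1 - ‖y‖ ^ 2) ≤ 8 := by
          rw [dens_eq hy1, mul_assoc, ← Real.rpow_add_one hyp.ne']
          have : (1 - ‖y‖ ^ 2) ^ (a n - 3 + 1) ≤ 1 :=
            Real.rpow_le_one hyp.le (by nlinarith [norm_nonneg y]) (by linarith [ha2 n])
          linarith
        nlinarith [mul_le_mul_of_nonneg_right (hGC y hy) hd, mul_le_mul_of_nonneg_left e hC]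
      have := h0 y hy.1
      gcongr
    have hsub : ball (0 : E3) 1 ∩ ball q δ ⊆ ball (0 : E3) 1 := inter_subset_left
    calc _ ≤ ∫ y in ball (0 : E3) 1 ∩ ball q δ,
          (m ^ (3 : ℝ))⁻¹ * ((η * dens (a n) y + 8 * C) / totalWeight (a n)) := by
          refine integral_mono_of_nonneg ?_ (hfi.mono_set hsub) ?_
          · refine ae_restrict_of_forall_mem hms fun y hy => mul_nonneg
              (inv_nonneg.2 (Real.rpow_nonneg (kerDen_pos hx y).le _))
              (div_nonneg (mul_nonneg (h0 y hy.1)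
                (dens_nonneg (by simpa using (mem_ball_zero_iff.1 hy.1).le) _)) pw.le)
          · exact ae_restrict_of_forall_mem hms hpt
      _ ≤ ∫ y in ball (0 : E3) 1,
          (m ^ (3 : ℝ))⁻¹ * ((η * dens (a n) y + 8 * C) / totalWeight (a n)) := by
          refine setIntegral_mono_set hfi (ae_restrict_of_forall_mem measurableSet_ball
            fun y hy => ?_) hsub.eventuallyLE
          have := dens_nonneg (mem_ball_zero_iff.1 hy).le (a n)
          simp only [Pi.zero_apply]
          positivity
      _ = (m ^ (3 : ℝ))⁻¹ * (η * ((∫ y in ball (0 : E3) 1, dens (a n) y) * (totalWeight (a n))⁻¹)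
          + 8 * C * V * (totalWeight (a n))⁻¹) := by
          rw [integral_const_mul, integral_div, integral_add (hdi.const_mul η) hci,
            integral_const_mul, setIntegral_const, ← hV, smul_eq_mul]
          ring
      _ ≤ _ := by
          have e1 : (∫ y in ball (0 : E3) 1, dens (a n) y) * (totalWeight (a n))⁻¹ ≤ 8 := by
            rw [← div_eq_mul_inv, div_le_iff₀ pw]
            refine (integral_dens_le (ha2 n)).trans (mul_le_mul_of_nonneg_right ?_ pw.le)
            calc (2 : ℝ) ^ a n ≤ 2 ^ (3 : ℝ) :=
                  Real.rpow_le_rpow_of_exponent_le one_le_two (ha3 n)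
              _ = 8 := by norm_num
          have e2 := inv_totalWeight_le (ha2 n) (ha3 n)
          have hV0 : 0 ≤ V := measureReal_nonneg
          rw [mul_comm (8 : ℝ) η]
          gcongr
  refine tendsto_order.2 ⟨fun b hb => Eventually.of_forall fun n => hb.trans_le (hnn n),
    fun b hb => ?_⟩
  have hm3 : 0 < m ^ (3 : ℝ) := Real.rpow_pos_of_pos hmpos _
  -- Chosen so that the limiting bound `8 η / m³` equals `b / 2`.
  set η := b * m ^ (3 : ℝ) / 16 with hη
  have hηpos : 0 < η := by positivity
  obtain ⟨C, hC, hGC⟩ := hlin η hηpos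
  have hlim : Tendsto (fun n => (m ^ (3 : ℝ))⁻¹ *
      (8 * η + 8 * C * V * ((a n - 2) / (3 * totalWeight 5)))) atTop
      (𝓝 ((m ^ (3 : ℝ))⁻¹ * (8 * η + 8 * C * V * ((2 - 2) / (3 * totalWeight 5))))) :=
    ((((ha.sub_const 2).div_const _).const_mul _).const_add _).const_mul _
  have hval : (m ^ (3 : ℝ))⁻¹ * (8 * η + 8 * C * V * ((2 - 2) / (3 * totalWeight 5))) < b := by
    rw [hη]
    simp only [sub_self, zero_div, mul_zero, add_zero]
    field_simp
    linarith
  filter_upwards [hlim.eventually (gt_mem_nhds hval)] with n hn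
  exact (hupper η hηpos C hC hGC n).trans_lt hn

/-! ### Factorization near a boundary point -/

/-- The function `kerDen x` on a subset of space. -/
def kerDenMap (S : Set E3) (x : E3) : C(S, ℝ) :=
  ⟨fun y => kerDen x y, (contDiff_kerDen x).continuous.comp continuous_subtype_val⟩

/-- `kerDen x y` is a finite sum of functions of `x` times functions of `y`, so the map stays in a
fixed finite-dimensional space of functions, with smooth coefficients. -/
lemma contDiff_kerDenMap (S : Set E3) [CompactSpace S] : ContDiff ℝ 2 (kerDenMap S) := by
  let A : C(S, ℝ) := ⟨fun y => 1 + ‖(y : E3)‖ ^ 2, by fun_prop⟩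
  let Y : Fin 3 → C(S, ℝ) := fun i => ⟨fun y => (y : E3) i, by fun_prop⟩
  have e : kerDenMap S = fun x =>
      (1 + ‖x‖ ^ 2) • A - (4 : ℝ) • ∑ i, x i • Y i := by
    funext x
    ext y
    simp [kerDenMap, A, Y, kerDen, inner_E3, Fin.sum_univ_three]
    ring
  have hn : ContDiff ℝ 2 fun x : E3 => ‖x‖ ^ 2 := contDiff_norm_sq ℝ
  have hi : ∀ i, ContDiff ℝ 2 fun x : E3 => x i := fun i =>
    (EuclideanSpace.proj i : E3 →L[ℝ] ℝ).contDiff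
  rw [e]
  exact ((contDiff_const.add hn).smul contDiff_const).sub
    ((ContDiff.sum fun i _ => (hi i).smul contDiff_const).const_smul (4 : ℝ))

/-- The representation of a harmonic function that vanishes on a portion of the sphere at
infinity: it is `(1 - |x|²)²` times a positive function that is smooth across that portion. -/
theorem exists_factor {G : E3 → ℝ} (hG : IsHypHarmonic G)
    (h0 : ∀ y ∈ ball (0 : E3) 1, 0 ≤ G y) (h1 : ∀ y ∈ ball (0 : E3) 1, G y ≤ 1) {q : E3}
    (hq : ‖q‖ = 1) {δ : ℝ} (hδ : 0 < δ)
    (hcont : ContinuousOn G (closedBall 0 1 ∩ closedBall q δ))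
    (hz : ∀ y ∈ closedBall q δ, ‖y‖ = 1 → G y = 0) (hne : ∃ x ∈ ball (0 : E3) 1, G x ≠ 0) :
    ∃ H : E3 → ℝ, ContDiffAt ℝ 2 H q ∧ 0 < H q ∧
      ∀ x ∈ ball (0 : E3) 1, G x = (1 - ‖x‖ ^ 2) ^ 2 * H x := by
  set S : Set E3 := closedBall 0 1 \ ball q δ with hS
  have hScpt : IsCompact S := (isCompact_closedBall 0 1).diff isOpen_ball
  have hSm : MeasurableSet S := hScpt.measurableSet
  have : CompactSpace S := isCompact_iff_compactSpace.1 hScpt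
  have hM : ∀ y ∈ ball (0 : E3) 1, |G y| ≤ 1 := fun y hy =>
    abs_le.2 ⟨by linarith [h0 y hy], h1 y hy⟩
  set a : ℕ → ℝ := fun n => 2 + 1 / ((n : ℝ) + 1) with ha
  have ha2 : ∀ n, 2 < a n := fun n => by
    have : (0 : ℝ) < 1 / ((n : ℝ) + 1) := by positivity
    simp only [ha]; linarith
  have ha3 : ∀ n, a n ≤ 3 := fun n => by
    have : 1 / ((n : ℝ) + 1) ≤ 1 := by
      rw [div_le_one (by positivity)]; linarith [n.cast_nonneg (α := ℝ)]
    simp only [ha]; linarith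
  have hat : Tendsto a atTop (𝓝 2) := by
    have := (tendsto_one_div_add_atTop_nhds_zero_nat (𝕜 := ℝ)).const_add 2
    rwa [add_zero] at this
  set w : ℕ → E3 → ℝ := fun n y => G y * dens (a n) y / totalWeight (a n) with hw
  have hwout : ∀ n, ∀ y : E3, ‖y‖ = 1 → w n y = 0 := fun n y hy => by
    simp [hw, dens_eq_zero hy]
  have hwnn : ∀ n, ∀ y ∈ closedBall (0 : E3) 1, 0 ≤ w n y := by
    intro n y hy
    rcases (mem_closedBall_zero_iff.1 hy).lt_or_eq with h | h
    · exact div_nonneg (mul_nonneg (h0 y (by simpa using h)) (dens_nonneg h.le _))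
        (totalWeight_pos (ha2 n)).le
    · exact (hwout n y h).ge
  have hwi : ∀ n, IntegrableOn (w n) (ball 0 1) := fun n =>
    ((integrableOn_dens (ha2 n)).bdd_mul (c := 1)
      (hG.1.continuousOn.aestronglyMeasurable measurableSet_ball)
      (ae_restrict_of_forall_mem measurableSet_ball fun y hy => hM y hy)).div_const _
  have hwic : ∀ n, IntegrableOn (w n) (closedBall 0 1) := fun n =>
    (hwi n).of_forall_sdiff_eq_zero measurableSet_closedBall fun y hy =>
      hwout n y (le_antisymm (by simpa using hy.1) (by simpa using hy.2))
  have hwmass : ∀ n, ∫ y in S, w n y ≤ 8 := by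
    intro n
    have pw := totalWeight_pos (ha2 n)
    calc ∫ y in S, w n y ≤ ∫ y in closedBall (0 : E3) 1, w n y :=
          setIntegral_mono_set (hwic n)
            (ae_restrict_of_forall_mem measurableSet_closedBall fun y hy => hwnn n y hy)
            sdiff_subset.eventuallyLE
      _ = ∫ y in ball (0 : E3) 1, w n y :=
          (setIntegral_eq_of_subset_of_forall_sdiff_eq_zero measurableSet_closedBall
            ball_subset_closedBall fun y hy =>
              hwout n y (le_antisymm (by simpa using hy.1) (by simpa using hy.2)))
      _ ≤ ∫ y in ball (0 : E3) 1, dens (a n) y / totalWeight (a n) := by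
          refine setIntegral_mono_on (hwi n) ((integrableOn_dens (ha2 n)).div_const _)
            measurableSet_ball fun y hy => ?_
          have := dens_nonneg (mem_ball_zero_iff.1 hy).le (a n)
          simp only [hw]
          gcongr
          nlinarith [h1 y hy]
      _ ≤ 8 := by
          rw [integral_div, div_le_iff₀ pw]
          refine (integral_dens_le (ha2 n)).trans (mul_le_mul_of_nonneg_right ?_ pw.le)
          calc (2 : ℝ) ^ a n ≤ 2 ^ (3 : ℝ) :=
                Real.rpow_le_rpow_of_exponent_le one_le_two (ha3 n)
            _ = 8 := by norm_num
  obtain ⟨ℓ, hℓpos, hℓ⟩ := exists_functional_of_bounded_mass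
    (Measure.comap ((↑) : S → E3) volume) (fun n y => w n y) (fun n y => hwnn n y y.2.1)
    (fun n => (integrableOn_iff_comap_subtypeVal hSm).1 ((hwic n).mono_set sdiff_subset))
    (M := 8) (fun n => by rw [integral_subtype_comap hSm (w n)]; exact hwmass n)
  -- `Ring.inverse` makes the formula total. It is a genuine inverse in the open ball and at `q`,
  -- since `kerDen q y = 2 |q - y|² ≥ 2 δ²` on `S`.
  set H : E3 → ℝ := fun x => ℓ (Ring.inverse (kerDenMap S x) ^ 2) with hH
  have hinv : ∀ x, (∀ y ∈ S, kerDen x y ≠ 0) → IsUnit (kerDenMap S x) ∧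
      ∀ y : S, Ring.inverse (kerDenMap S x) y = (kerDen x y)⁻¹ := by
    intro x hx
    have hu : IsUnit (kerDenMap S x) :=
      (ContinuousMap.isUnit_iff_forall_ne_zero _).2 fun y => hx y y.2
    refine ⟨hu, fun y => ?_⟩
    have := congrArg (fun φ : C(S, ℝ) => φ y) (Ring.mul_inverse_cancel _ hu)
    simp only [ContinuousMap.mul_apply, ContinuousMap.one_apply] at this
    exact eq_inv_of_mul_eq_one_right this
  have hkball : ∀ x ∈ ball (0 : E3) 1, ∀ y ∈ S, kerDen x y ≠ 0 := fun x hx y _ =>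
    (kerDen_pos (by simpa using hx) y).ne'
  have hkq : ∀ y ∈ S, kerDen q y ≠ 0 := by
    intro y hy h
    rw [kerDen_eq, hq] at h
    have : δ ≤ ‖q - y‖ := by
      rw [← dist_eq_norm, dist_comm]
      simpa using hy.2
    nlinarith
  have hrep : ∀ x ∈ ball (0 : E3) 1, G x = (1 - ‖x‖ ^ 2) ^ 2 * H x := by
    intro x hxb
    have hx : ‖x‖ < 1 := by simpa using hxb
    have hxp := one_sub_norm_sq_pos hx
    have hcurry : Continuous fun p : ℝ × S => (kerDen x p.2 ^ p.1)⁻¹ := by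
      refine Continuous.inv₀ ?_ fun p => (Real.rpow_pos_of_pos (kerDen_pos hx _) _).ne'
      exact (((contDiff_kerDen x).continuous.comp continuous_subtype_val).comp
        continuous_snd).rpow continuous_fst fun p => Or.inl (kerDen_pos hx _).ne'
    -- Currying turns joint continuity in exponent and point into uniform convergence of the kernels
    -- as the exponent tends to `2`.
    let φ : C(ℝ, C(S, ℝ)) := ContinuousMap.curry ⟨_, hcurry⟩
    have hφ2 : φ 2 = Ring.inverse (kerDenMap S x) ^ 2 := by
      ext y
      rw [ContinuousMap.pow_apply, (hinv x (hkball x hxb)).2 y]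
      simp [φ]
    have hlim : Tendsto (fun n => φ (a n)) atTop (𝓝 (φ 2)) := (φ.continuous.tendsto 2).comp hat
    -- The integral representation of `G x`, minus the part near `q` that disappears in the limit.
    have hsplit : ∀ n, ∫ y : S, φ (a n) y * w n y ∂(Measure.comap ((↑) : S → E3) volume)
        = G x * ((1 - ‖x‖ ^ 2) ^ a n)⁻¹
          - ∫ y in ball (0 : E3) 1 ∩ ball q δ, (kerDen x y ^ a n)⁻¹ * w n y := by
      intro n
      have e1 : ∫ y : S, φ (a n) y * w n y ∂(Measure.comap ((↑) : S → E3) volume)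
          = ∫ y in S, (kerDen x y ^ a n)⁻¹ * w n y :=
        integral_subtype_comap hSm fun y => (kerDen x y ^ a n)⁻¹ * w n y
      have e2 : ∫ y in S, (kerDen x y ^ a n)⁻¹ * w n y
          = ∫ y in ball (0 : E3) 1 \ ball q δ, (kerDen x y ^ a n)⁻¹ * w n y := by
        refine setIntegral_eq_of_subset_of_forall_sdiff_eq_zero hSm
          (sdiff_subset_sdiff_left ball_subset_closedBall) fun y hy => ?_
        have : ‖y‖ = 1 := le_antisymm (by simpa using hy.1.1) (by
          by_contra hc
          exact hy.2 ⟨by simpa using hc, hy.1.2⟩)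
        rw [hwout n y this, mul_zero]
      have hint : IntegrableOn (fun y => (kerDen x y ^ a n)⁻¹ * w n y) (ball 0 1) := by
        refine (hwi n).bdd_mul (c := (((1 - ‖x‖) ^ 2) ^ a n)⁻¹) ?_
          (Eventually.of_forall fun y => ?_)
        · refine Continuous.aestronglyMeasurable ?_
          refine Continuous.inv₀ ?_ fun y => (Real.rpow_pos_of_pos (kerDen_pos hx _) _).ne'
          exact (contDiff_kerDen x).continuous.rpow_const fun y => Or.inl (kerDen_pos hx _).ne'
        · have hx1 : 0 < 1 - ‖x‖ := by linarith
          rw [Real.norm_of_nonneg (inv_nonneg.2 (Real.rpow_nonneg (kerDen_pos hx _).le _))]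
          have := kerDen_ge hx y
          have := ha2 n
          gcongr
      have e3 := integral_inter_add_sdiff (μ := (volume : Measure E3)) (s := ball 0 1)
        (t := ball q δ) measurableSet_ball hint
      have e4 := eq_integral_dens hG hM hx (ha2 n)
      have hpp : (1 - ‖x‖ ^ 2) ^ a n ≠ 0 := (Real.rpow_pos_of_pos hxp _).ne'
      rw [e1, e2, e4, ← e3]
      field_simp
      ring
    have hG' : ℓ (φ 2) = G x * ((1 - ‖x‖ ^ 2) ^ (2 : ℝ))⁻¹ - 0 := by
      refine hℓ (fun n => φ (a n)) (φ 2) _ hlim ?_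
      simp only [hsplit]
      refine Tendsto.sub ?_ (tendsto_mass_near h0 h1 hcont hz hx ha2 ha3 hat)
      refine Tendsto.const_mul _ (Tendsto.inv₀ ?_ (Real.rpow_pos_of_pos hxp _).ne')
      exact tendsto_const_nhds.rpow hat (Or.inl hxp.ne')
    have hpow : (1 - ‖x‖ ^ 2) ^ (2 : ℝ) = (1 - ‖x‖ ^ 2) ^ 2 := by norm_num
    rw [hH]
    simp only
    rw [← hφ2, hG', hpow, sub_zero]
    field_simp
  refine ⟨H, ?_, ?_, hrep⟩
  · obtain ⟨u, hu⟩ := (hinv q hkq).1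
    have h2 : ContDiffAt ℝ 2 (fun x => Ring.inverse (kerDenMap S x)) q := by
      refine ContDiffAt.comp q (g := Ring.inverse) ?_ (contDiff_kerDenMap S).contDiffAt
      rw [← hu]
      exact contDiffAt_ringInverse ℝ u
    exact ℓ.contDiff.contDiffAt.comp q (h2.pow 2)
  · have hqnn : 0 ≤ H q := hℓpos _ fun y => by
      rw [ContinuousMap.pow_apply]; positivity
    refine lt_of_le_of_ne hqnn fun hq0 => ?_
    obtain ⟨x, hxb, hxne⟩ := hne
    have hx : ‖x‖ < 1 := by simpa using hxb
    have hx1 : 0 < 1 - ‖x‖ := by linarith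
    have hxpos : 0 < G x := lt_of_le_of_ne (h0 x hxb) hxne.symm
    -- A Harnack-type comparison of kernels: `kerDen q y ≤ 8` and `kerDen x y ≥ (1 - |x|)²` give `H
    -- x ≤ C * H q`, so `H q = 0` would force `G x = 0`.
    set C : ℝ := 64 * ((((1 - ‖x‖) ^ 2) ^ 2)⁻¹) with hC
    have hdiff : 0 ≤ ℓ (C • Ring.inverse (kerDenMap S q) ^ 2
        - Ring.inverse (kerDenMap S x) ^ 2) := by
      refine hℓpos _ fun y => ?_
      rw [ContinuousMap.sub_apply, ContinuousMap.smul_apply, ContinuousMap.pow_apply,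
        ContinuousMap.pow_apply, (hinv q hkq).2, (hinv x (hkball x hxb)).2, smul_eq_mul,
        inv_pow, inv_pow]
      have k1 : (kerDen x y ^ 2)⁻¹ ≤ (((1 - ‖x‖) ^ 2) ^ 2)⁻¹ := by
        have := kerDen_ge hx (y : E3)
        gcongr
      have hy1 : ‖(y : E3)‖ ≤ 1 := by simpa using y.2.1
      have hnn : 0 ≤ kerDen q y := by rw [kerDen_eq, hq]; nlinarith [sq_nonneg ‖q - (y : E3)‖]
      have k2 : kerDen q y ≤ 8 := by
        have h4 : ‖q - (y : E3)‖ ≤ 2 := (norm_sub_le _ _).trans (by linarith)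
        rw [kerDen_eq, hq]
        nlinarith [norm_nonneg (q - (y : E3))]
      have hpos : 0 < kerDen q y ^ 2 := by
        have := hkq y y.2
        positivity
      have k3 : 1 ≤ 64 * (kerDen q y ^ 2)⁻¹ := by
        rw [← div_eq_mul_inv, one_le_div hpos]
        nlinarith
      have k4 : 0 ≤ (((1 - ‖x‖) ^ 2) ^ 2)⁻¹ := by positivity
      rw [hC]
      nlinarith [mul_le_mul_of_nonneg_left k3 k4]
    rw [map_sub, map_smul, smul_eq_mul] at hdiff
    change 0 ≤ C * H q - H x at hdiff
    rw [← hq0, mul_zero] at hdiff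
    have := hrep x hxb
    have h2 : 0 < (1 - ‖x‖ ^ 2) ^ 2 := pow_pos (one_sub_norm_sq_pos hx) 2
    nlinarith

/-! ### One-sided derivatives at a double zero -/

lemma differentiableWithinAt_derivWithin {g : ℝ → ℝ} {s : Set ℝ} {t : ℝ}
    (hs : UniqueDiffOn ℝ s) (ht : t ∈ s) (hg : ContDiffWithinAt ℝ 2 g s t) :
    DifferentiableWithinAt ℝ (derivWithin g s) s t :=
  ((hg.fderivWithin_right (m := 1) hs (by norm_num) ht).clm_apply
    contDiffWithinAt_const).differentiableWithinAt (by norm_num)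

/-- One-sided derivatives of `κ + g² h` at a zero of `g`. -/
lemma iteratedDerivWithin_add_sq_mul {ε κ : ℝ} (hε : 0 < ε) {u g h : ℝ → ℝ}
    (hg : ContDiffWithinAt ℝ 2 g (Icc 0 ε) 0) (hh : ContDiffWithinAt ℝ 2 h (Icc 0 ε) 0)
    (hg0 : g 0 = 0) (hu : u =ᶠ[𝓝[Icc 0 ε] 0] fun t => κ + g t ^ 2 * h t) :
    iteratedDerivWithin 1 u (Icc 0 ε) 0 = 0 ∧
      iteratedDerivWithin 2 u (Icc 0 ε) 0 = 2 * derivWithin g (Icc 0 ε) 0 ^ 2 * h 0 := by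
  set s := Icc (0 : ℝ) ε with hs
  have hsu : UniqueDiffOn ℝ s := uniqueDiffOn_Icc hε
  have h0s : (0 : ℝ) ∈ s := left_mem_Icc.2 hε.le
  have hins : insert (0 : ℝ) s = s := insert_eq_of_mem h0s
  have hev : ∀ {k : ℝ → ℝ}, ContDiffWithinAt ℝ 2 k s 0 →
      ∀ᶠ t in 𝓝[s] 0, DifferentiableWithinAt ℝ k s t := by
    intro k hk
    have := hk.eventually (by norm_num)
    rw [hins] at this
    exact this.mono fun t ht => ht.differentiableWithinAt (by norm_num)
  -- Factoring out `g`, which vanishes at `0`, leaves only the derivative of `g` times the bracket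
  -- at `0`.
  have hd : derivWithin u s =ᶠ[𝓝[s] 0] fun t =>
      g t * (2 * derivWithin g s t * h t + g t * derivWithin h s t) := by
    filter_upwards [hev hg, hev hh, eventually_eventually_nhdsWithin.2 hu, self_mem_nhdsWithin]
      with t htg hth htu hts
    rw [Filter.EventuallyEq.derivWithin_eq_of_mem htu hts]
    have := ((htg.hasDerivWithinAt.fun_pow 2).fun_mul hth.hasDerivWithinAt).const_add κ
    rw [this.derivWithin (hsu t hts)]
    push_cast
    ring
  have hd0 : derivWithin u s 0 = 0 := by
    rw [hd.self_of_nhdsWithin h0s]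
    simp only [hg0, zero_mul]
  refine ⟨by rw [iteratedDerivWithin_one, hd0], ?_⟩
  have h2 : iteratedDerivWithin 2 u s 0 = derivWithin (derivWithin u s) s 0 := by
    rw [show 2 = 1 + 1 from rfl, iteratedDerivWithin_succ, iteratedDerivWithin_one]
  have dg := hg.differentiableWithinAt (n := 2) (by norm_num)
  have dh := hh.differentiableWithinAt (n := 2) (by norm_num)
  have dg' := differentiableWithinAt_derivWithin hsu h0s hg
  have dh' := differentiableWithinAt_derivWithin hsu h0s hh
  have dk : DifferentiableWithinAt ℝ
      (fun t => 2 * derivWithin g s t * h t + g t * derivWithin h s t) s 0 :=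
    ((dg'.const_mul 2).fun_mul dh).fun_add (dg.fun_mul dh')
  rw [h2, hd.derivWithin_eq_of_mem h0s, derivWithin_fun_mul dg dk, hg0]
  ring

/-! ### The tunnel-vision function near a boundary point -/

variable {Γ : Subgroup PSL(2, ℂ)}

lemma ball_subset_domain (Γ : Subgroup PSL(2, ℂ)) : ball (0 : E3) 1 ⊆ domain Γ := by
  intro x hx
  have hx1 : ‖x‖ < 1 := by simpa using hx
  refine ⟨hx1.le, fun q _ h => ?_⟩
  rw [← h, q.2] at hx1
  exact lt_irrefl _ hx1

lemma domain_subset_closedBall (Γ : Subgroup PSL(2, ℂ)) : domain Γ ⊆ closedBall (0 : E3) 1 :=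
  fun _ hx => by simpa using hx.1

lemma isClosed_limitSet (Γ : Subgroup PSL(2, ℂ)) : IsClosed (limitSet Γ) := by
  have hc : Continuous S2.toD3 := Continuous.subtype_mk continuous_subtype_val _
  exact (isClosed_derivedSet (MulAction.orbit Γ center)).preimage hc

/-- The limit set is closed in the sphere, hence in space, so a point off it has a whole
neighborhood in the closed ball off it. -/
lemma exists_closedBall_inter_subset_domain {q : E3} (hq : q ∈ domain Γ) :
    ∃ δ > 0, closedBall 0 1 ∩ closedBall q δ ⊆ domain Γ := by
  have hS : IsClosed {x : E3 | ‖x‖ = 1} := isClosed_eq continuous_norm continuous_const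
  have hc : IsClosed (((↑) : S2 → E3) '' limitSet Γ) :=
    hS.isClosedEmbedding_subtypeVal.isClosedMap _ (isClosed_limitSet Γ)
  have hqn : q ∈ (((↑) : S2 → E3) '' limitSet Γ)ᶜ := by
    rintro ⟨p, hp, rfl⟩
    exact hq.2 p hp rfl
  obtain ⟨δ, hδ, hsub⟩ := nhds_basis_closedBall.mem_iff.1 (hc.isOpen_compl.mem_nhds hqn)
  exact ⟨δ, hδ, fun x hx => ⟨by simpa using hx.1, fun p hp h => hsub hx.2 ⟨p, hp, h⟩⟩⟩

lemma pullback_of_mem {f : Xbar Γ → ℝ} {x : E3} (hx : x ∈ domain Γ) :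
    pullback f x = f (Quotient.mk (orbitSetoid Γ) ⟨x, hx⟩) := dif_pos hx

lemma continuousOn_pullback {f : Xbar Γ → ℝ} (hf : Continuous f) :
    ContinuousOn (pullback f) (domain Γ) := by
  rw [continuousOn_iff_continuous_domRestrict]
  refine (hf.comp continuous_quotient_mk').congr fun x => ?_
  exact (pullback_of_mem x.2).symm

lemma isHypHarmonic_one_sub {F : E3 → ℝ} (hF : IsHypHarmonic F) :
    IsHypHarmonic fun x => 1 - F x := by
  refine ⟨contDiffOn_const.sub hF.1, fun x hx => ?_⟩
  have hFx : ContDiffAt ℝ 2 F x := hF.1.contDiffAt (isOpen_ball.mem_nhds hx)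
  have h1 : Laplacian.laplacian (fun x => 1 - F x) x = - Laplacian.laplacian F x := by
    have hc : Laplacian.laplacian (fun _ : E3 => (1 : ℝ)) = 0 := laplacian_const
    have := ContDiffAt.laplacian_sub (f₁ := fun _ : E3 => (1 : ℝ)) contDiffAt_const hFx
    rw [hc, Pi.zero_apply, zero_sub] at this
    exact this
  have h2 := hF.2 x hx
  rw [hypLaplacian] at h2 ⊢
  rw [h1, fderiv_const_sub, neg_apply]
  linarith

/-- The expansion of the tunnel-vision function at a boundary point. -/
lemma IsTunnelVision.exists_expansion {Sp Sm : Set (Xbar Γ)} (hS : IsBoundaryPair Γ Sp Sm)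
    {f : Xbar Γ → ℝ} (hf : IsTunnelVision Γ Sp Sm f) {q : E3} (hq : q ∈ domain Γ)
    (hq1 : ‖q‖ = 1) :
    ∃ (κ : ℝ) (H : E3 → ℝ), ContDiffAt ℝ 2 H q ∧ H q ≠ 0 ∧
      ∀ᶠ x in 𝓝[domain Γ] q, pullback f x = κ + (1 - ‖x‖ ^ 2) ^ 2 * H x := by
  have hcont := continuousOn_pullback hf.continuous
  have hI : ∀ x ∈ domain Γ, pullback f x ∈ Icc (0 : ℝ) 1 := fun x hx => by
    rw [pullback_of_mem hx]; exact hf.mem_Icc _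
  have hval : ∀ x ∈ domain Γ, ‖x‖ = 1 → pullback f x = 0 ∨ pullback f x = 1 := by
    intro x hx hx1
    have hb : Quotient.mk (orbitSetoid Γ) ⟨x, hx⟩ ∈ Sp ∪ Sm := by
      rw [hS.union]; exact ⟨⟨x, hx⟩, hx1, rfl⟩
    rw [pullback_of_mem hx]
    rcases hb with h | h
    · exact Or.inr (hf.eq_one _ h)
    · exact Or.inl (hf.eq_zero _ h)
  have hone : ∃ x ∈ domain Γ, pullback f x = 1 := by
    obtain ⟨p, hp, hSp⟩ := hS.comp_pos
    obtain ⟨x, -, hx⟩ := id hp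
    refine ⟨x, x.2, ?_⟩
    rw [pullback_of_mem x.2]
    refine hf.eq_one _ ?_
    rw [hSp]
    change Quotient.mk (orbitSetoid Γ) x ∈ _
    rw [hx]
    exact mem_connectedComponentIn hp
  have hzero : ∃ x ∈ domain Γ, pullback f x = 0 := by
    obtain ⟨p, hp, hSm⟩ := hS.comp_neg
    obtain ⟨x, -, hx⟩ := id hp
    refine ⟨x, x.2, ?_⟩
    rw [pullback_of_mem x.2]
    refine hf.eq_zero _ ?_
    rw [hSm]
    change Quotient.mk (orbitSetoid Γ) x ∈ _
    rw [hx]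
    exact mem_connectedComponentIn hp
  -- By density, constancy inside the ball would extend to the boundary, where both values `0` and
  -- `1` occur; this yields the nonvanishing needed by `exists_factor`.
  have hnc : ∀ κ : ℝ, (∀ x ∈ ball (0 : E3) 1, pullback f x = κ) →
      ∀ x ∈ domain Γ, pullback f x = κ := by
    intro κ hκ x hx
    have hcl : domain Γ ⊆ closure (ball (0 : E3) 1) := by
      rw [closure_ball _ one_ne_zero]; exact domain_subset_closedBall Γ
    exact EqOn.of_subset_closure (t := domain Γ) (fun y hy => hκ y hy) hcont continuousOn_const
      (ball_subset_domain Γ) hcl hx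
  obtain ⟨δ₁, hδ₁, hsub₁⟩ := exists_closedBall_inter_subset_domain hq
  obtain ⟨δ₂, hδ₂, hsub₂⟩ : ∃ δ > 0, ∀ x ∈ domain Γ, dist x q < δ →
      dist (pullback f x) (pullback f q) < 1 :=
    Metric.continuousOn_iff.1 hcont q hq 1 one_pos
  set δ := min δ₁ (δ₂ / 2) with hδdef
  have hδ : 0 < δ := lt_min hδ₁ (by linarith)
  have hsub : closedBall 0 1 ∩ closedBall q δ ⊆ domain Γ := fun x hx =>
    hsub₁ ⟨hx.1, closedBall_subset_closedBall (min_le_left _ _) hx.2⟩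
  -- Boundary values lie in `{0, 1}` and differ from the value at `q` by less than `1`.
  have hconst : ∀ x ∈ closedBall q δ, ‖x‖ = 1 → pullback f x = pullback f q := by
    intro x hx hx1
    have hxd : x ∈ domain Γ := hsub ⟨by simp [hx1], hx⟩
    have hd : dist x q < δ₂ := by
      have h1 := mem_closedBall.1 hx
      have h2 : δ ≤ δ₂ / 2 := min_le_right _ _
      linarith
    have h3 := hsub₂ x hxd hd
    rw [Real.dist_eq, abs_lt] at h3
    rcases hval x hxd hx1 with h | h <;> rcases hval q hq hq1 with h' | h' <;>
      rw [h, h'] at h3 ⊢ <;> linarith [h3.1, h3.2]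
  have hnear : ∀ᶠ x in 𝓝[domain Γ] q, x ∈ domain Γ ∧ x ∈ closedBall q δ :=
    Filter.Eventually.and self_mem_nhdsWithin
      (mem_nhdsWithin_of_mem_nhds (closedBall_mem_nhds q hδ))
  have hballIcc : ∀ x ∈ ball (0 : E3) 1, pullback f x ∈ Icc (0 : ℝ) 1 := fun x hx =>
    hI x (ball_subset_domain Γ hx)
  rcases hval q hq hq1 with hκ | hκ
  · obtain ⟨H, hH, hHq, hrep⟩ := exists_factor hf.harmonic (fun y hy => (hballIcc y hy).1)
      (fun y hy => (hballIcc y hy).2) hq1 hδ (hcont.mono hsub)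
      (fun y hy hy1 => (hconst y hy hy1).trans hκ) (by
        by_contra! hc
        obtain ⟨x, hx, hx1⟩ := hone
        exact zero_ne_one ((hnc 0 hc x hx).symm.trans hx1))
    refine ⟨0, H, hH, hHq.ne', hnear.mono fun x hx => ?_⟩
    rcases hx.1.1.lt_or_eq with h | h
    · rw [zero_add]; exact hrep x (by simpa using h)
    · rw [hconst x hx.2 h, hκ, h]; ring
  · obtain ⟨H, hH, hHq, hrep⟩ := exists_factor (isHypHarmonic_one_sub hf.harmonic)
      (fun y hy => by linarith [(hballIcc y hy).2]) (fun y hy => by linarith [(hballIcc y hy).1])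
      hq1 hδ (continuousOn_const.sub (hcont.mono hsub))
      (fun y hy hy1 => by rw [hconst y hy hy1, hκ, sub_self]) (by
        by_contra! hc
        obtain ⟨x, hx, hx0⟩ := hzero
        exact zero_ne_one (hx0.symm.trans (hnc 1 (fun y hy => by linarith [hc y hy]) x hx)))
    refine ⟨1, fun x => -H x, hH.neg, neg_ne_zero.2 hHq.ne', hnear.mono fun x hx => ?_⟩
    rcases hx.1.1.lt_or_eq with h | h
    · have := hrep x (by simpa using h)
      linarith
    · rw [hconst x hx.2 h, hκ, h]; ring

end QuasiFuchsian
end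
open QuasiFuchsian in
theorem mainTheorem9 (Γ : Subgroup PSL(2, ℂ)) (hΓ : IsBersType Γ)
    (Sp Sm : Set (Xbar Γ)) (hS : IsBoundaryPair Γ Sp Sm)
    (f : Xbar Γ → ℝ) (hf : IsTunnelVision Γ Sp Sm f) :
    ContDiffOn ℝ 2 (pullback f) (domain Γ) ∧
      ∀ q ∈ domain Γ, ‖q‖ = 1 → ∀ (ε : ℝ) (c : ℝ → E3), IsNormalCurve Γ q ε c →
        iteratedDerivWithin 1 (fun t => pullback f (c t)) (Set.Icc 0 ε) 0 = 0 ∧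
        iteratedDerivWithin 2 (fun t => pullback f (c t)) (Set.Icc 0 ε) 0 ≠ 0 := by
  have hn : ContDiff ℝ 2 fun x : E3 => ‖x‖ ^ 2 := contDiff_norm_sq ℝ
  refine ⟨fun x hx => ?_, fun q hq hq1 ε c hc => ?_⟩
  · rcases hx.1.lt_or_eq with h | h
    · exact (hf.harmonic.1.contDiffAt
        (Metric.isOpen_ball.mem_nhds (by simpa using h))).contDiffWithinAt
    · obtain ⟨κ, H, hH, -, hrep⟩ := hf.exists_expansion hS hx h
      refine ContDiffWithinAt.congr_of_eventuallyEq_of_mem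
        (f := fun x => κ + (1 - ‖x‖ ^ 2) ^ 2 * H x) ?_ hrep hx
      exact (contDiffAt_const.add
        (((contDiffAt_const.sub hn.contDiffAt).pow 2).mul hH)).contDiffWithinAt
  · obtain ⟨κ, H, hH, hHq, hrep⟩ := hf.exists_expansion hS hq hq1
    obtain ⟨l, hl, hl'⟩ := hc.normal
    have h0 : (0 : ℝ) ∈ Set.Icc 0 ε := Set.left_mem_Icc.2 hc.pos.le
    have hc0 := hc.contDiffOn 0 h0
    have hct : Filter.Tendsto c (𝓝[Set.Icc 0 ε] 0) (𝓝[domain Γ] q) := by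
      refine tendsto_nhdsWithin_iff.2 ⟨?_, ?_⟩
      · have := hc0.continuousWithinAt
        rwa [ContinuousWithinAt, hc.start] at this
      · filter_upwards [self_mem_nhdsWithin] with t ht using hc.mapsTo ht
    have hg : ContDiffWithinAt ℝ 2 (fun t => 1 - ‖c t‖ ^ 2) (Set.Icc 0 ε) 0 :=
      contDiffWithinAt_const.sub (hn.contDiffAt.comp_contDiffWithinAt 0 hc0)
    have hh : ContDiffWithinAt ℝ 2 (fun t => H (c t)) (Set.Icc 0 ε) 0 := by
      rw [← hc.start] at hH
      exact hH.comp_contDiffWithinAt 0 hc0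
    obtain ⟨h1, h2⟩ := iteratedDerivWithin_add_sq_mul (κ := κ) hc.pos hg hh
      (by rw [hc.start, hq1]; norm_num) (hct.eventually hrep)
    refine ⟨h1, ?_⟩
    have hcd := (hc0.differentiableWithinAt (by norm_num)).hasDerivWithinAt
    -- The derivative is `-2 ⟨q, -l q⟩ = 2 l`, so the second derivative of the function is `8 l²
    -- H(q)`.
    have hgd : derivWithin (fun t => 1 - ‖c t‖ ^ 2) (Set.Icc 0 ε) 0 = 2 * l := by
      have := (hcd.norm_sq.const_sub 1).derivWithin (uniqueDiffOn_Icc hc.pos 0 h0)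
      refine Eq.trans this ?_
      rw [hl', hc.start, inner_neg_right, real_inner_smul_right, real_inner_self_eq_norm_sq, hq1]
      ring
    rw [h2, hgd, hc.start]
    exact mul_ne_zero (by positivity) hHq
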